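/- **Lemma 1.** A server holds $N$ files $W_1,\dots,W_N$ of $F$ bits each and serves $K\ge 2$ users over a shared error-free link, where $K$ divides $\binom K2$ (i.e. $K$ is odd). Let $0\le N_h\le N$; files $1,\dots,N_h$ are called high-level, the others low-level. Each file is divided into $\binom K2$ disjoint sub-files $W_{n,I}$ of equal size $b=F/\binom K2\ge 1$ bits, indexed by the sets $I\subseteq[K]$, $|I|=2$. *Placement of the $\mathrm{CL}(2,1)$ scheme.* If $n\le N_h$, then $W_{n,I}$ is cached by the two users in $I$. If $n>N_h$, then the sub-files of $W_n$ are divided arbitrarily into $K$ disjoint classes of equal size, and each user caches a different class. *Delivery of the $\mathrm{CL}(2,1)$ scheme.* For a demand vector $\mathbf d\in[N]^K$ let $\mathcal K^h,\mathcal K^l$ be the sets of users requesting high-level and low-level files, and $k^h=|\mathcal K^h|$, $k^l=|\mathcal K^l|$. For users $r,c$ let $A_{r,c}$ be the set of sub-files that $r$ requests and does not cache and that $c$ caches. *Level-1 delivery* within a set of users means: for every pair $j\ne k$ of them, match $A_{j,k}$ and $A_{k,j}$ one to one and send the XOR of each matched pair. If $k^h\ge2$, the messages are sent in four steps. (1)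 For each $\mathcal S\subseteq\mathcal K^h$ with $|\mathcal S|=3$, send $\bigoplus_{s\in\mathcal S}W_{d_s,\mathcal S\setminus\{s\}}$. (2) Level-1 delivery within $\mathcal K^l$. (3) For $i\in\mathcal K^h$, the set of index sets of the sub-files that $i$ requests and that are cached by low-level users only (it is the same for all $i$) is partitioned, in the same way for all $i$, into parts $\Lambda_{i,j}\subseteq A_{i,j}$, $j\in\mathcal K^l$, whose sizes differ by at most one; with $\Omega_{i,j}$ the set of sub-files in $A_{i,j}$ that are also cached by a high-level user, and some $\Delta_{i,j}\subseteq\Omega_{i,j}$, the sets $\Lambda_{i,j}\cup(\Omega_{i,j}\setminus\Delta_{i,j})$ and $A_{j,i}$ are matched one to one for all $i\in\mathcal K^h$, $j\in\mathcal K^l$, and the XOR of each matched pair is sent. (4) The sub-files in the sets $\Delta_{i,j}$, each taken once for the user $i$ that needs it, are partitioned into messages, each the XOR of two sub-files needed by two different high-level users each of whom caches the sub-file needed by the other, except for at most one message that is a single sub-file. If $k^h\le1$, the requested high-level file, if there is one, is treated as a low-level file: of the two cached copies of each of its sub-files only one is used, in such a way that every user contributes equally many sub-files; then level-1 delivery within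 $[K]$ is used. *Claim.* Such placements exist. For each of them, every user caches exactly $M(N_h,N,2,1)\,F$ bits, where $M(N_h,N,t,1)=\frac{N_h(t-1)+N}{K}$. For every demand vector $\mathbf d$, the total number of pairs (user, requested sub-file not cached by that user) is $$L(\mathbf d)=(K-1)\Big[\tfrac{K^2}{2}-k^h-\tfrac{k^l}{2}\Big],$$ and there is a delivery of the above form from which, together with its cache content, every user recovers the file it requests (for all contents of the files), and whose rate (number of transmitted bits divided by $F$) is $$R(\mathbf d)=\begin{cases}\dfrac{\binom{k^h}{3}+\Big\lceil\big(L(\mathbf d)-3\binom{k^h}{3}\big)/2\Big\rceil}{\binom K2},& k^h\ge2,\\[2ex] \dfrac{K-1}{2},& k^h<2.\end{cases}$$ -/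

import Mathlib

namespace CL21

/-- Sub-file indices: the two-element subsets of the set of users. -/
abbrev Pair (K : ℕ) := {I : Finset (Fin K) // I.card = 2}

/-- A library of `N` files of `F` bits each. -/
abbrev Library (N F : ℕ) := Fin N → Fin F → ZMod 2

/-- A sub-file level (uncoded) placement: `P n I` is the set of users that cache the sub-file of
file `n` with index `I`. -/
abbrev Placement (K N : ℕ) := Fin N → Pair K → Finset (Fin K)

/-- The pair `(s, I)` stands for the sub-file with index `I` of the file requested by user `s`;
a message is the XOR of the sub-files that it lists. -/
abbrev Message (K : ℕ) := Finset (Fin K × Pair K)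

variable {K N : ℕ}

/-- Every sub-file of file `n` is cached by exactly one user, and all users cache the same number
of sub-files of `n`. -/
def EvenlySplit (P : Placement K N) (n : Fin N) : Prop :=
  (∀ I, (P n I).card = 1) ∧
    ∀ u : Fin K, K * (Finset.univ.filter fun I : Pair K => u ∈ P n I).card = K.choose 2

/-- The placement phase: the first `Nh` files (the high-level ones) are cached at level 2, all
other files (the low-level ones) are evenly split. -/
def IsCL21Placement (Nh : ℕ) (P : Placement K N) : Prop :=
  (∀ n : Fin N, n.val < Nh → ∀ I, P n I = I.1) ∧ ∀ n : Fin N, Nh ≤ n.val → EvenlySplit P n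

/-- The set of bits (file, position in the file) in the cache of user `u`. The bijection `split`
divides each file of `F` bits into disjoint sub-files of `b` bits. -/
def cachedBits {F b : ℕ} (split : Fin F ≃ Pair K × Fin b) (P : Placement K N) (u : Fin K) :
    Finset (Fin N × Fin F) :=
  Finset.univ.filter fun x => u ∈ P x.1 (split x.2).1

/-- The cache size `M(Nh, N, t, 1)`, in units of the file size. -/
def cacheSize (K Nh N t : ℕ) : ℚ := (Nh * ((t : ℚ) - 1) + N) / K

/-- High-level users. -/
def highUsers (Nh : ℕ) (d : Fin K → Fin N) : Finset (Fin K) :=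
  Finset.univ.filter fun u => (d u).val < Nh

/-- Low-level users. -/
def lowUsers (Nh : ℕ) (d : Fin K → Fin N) : Finset (Fin K) :=
  Finset.univ.filter fun u => Nh ≤ (d u).val

/-- Indices of the sub-files that user `u` requests and does not cache. -/
def missing (P : Placement K N) (d : Fin K → Fin N) (u : Fin K) : Finset (Pair K) :=
  Finset.univ.filter fun I => u ∉ P (d u) I

/-- Indices of the sub-files that user `r` requests and misses and that user `c` caches. -/
def avail (P : Placement K N) (d : Fin K → Fin N) (r c : Fin K) : Finset (Pair K) :=
  (missing P d r).filter fun I => c ∈ P (d r) I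

/-- `Ω i j`: missing sub-files of user `i` that are cached by user `j` and by a high-level user. -/
def Omega (Nh : ℕ) (P : Placement K N) (d : Fin K → Fin N) (i j : Fin K) : Finset (Pair K) :=
  (avail P d i j).filter fun I => ∃ k ∈ highUsers Nh d, k ∈ P (d i) I

/-- `Λ i`: missing sub-files of user `i` that are cached by low-level users only. -/
def Lam (Nh : ℕ) (P : Placement K N) (d : Fin K → Fin N) (i : Fin K) : Finset (Pair K) :=
  (missing P d i).filter fun I => P (d i) I ⊆ lowUsers Nh d

/-- Level-2 coded delivery within a set `A` of users: for every three-element `S ⊆ A`, the XOR over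
`s ∈ S` of the sub-file with index `S \ {s}` requested by `s`. -/
def tripleMessages (A : Finset (Fin K)) : Finset (Message K) :=
  (A.powersetCard 3).image fun S => Finset.univ.filter fun x => x.1 ∈ S ∧ x.2.1 = S.erase x.1

/-- Level-1 coded delivery within a set `A` of users: for all `j < k` in `A`, the sub-files that `j`
needs from `k` and those that `k` needs from `j` are matched one to one and XORed. -/
def IsLevelOneDelivery (P : Placement K N) (d : Fin K → Fin N) (A : Finset (Fin K))
    (D : Finset (Message K)) : Prop :=
  ∃ e : Fin K → Fin K → Pair K → Pair K,
    (∀ j ∈ A, ∀ k ∈ A, j < k →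
      Set.BijOn (e j k) (avail P d j k : Set (Pair K)) (avail P d k j : Set (Pair K))) ∧
    ∀ m, m ∈ D ↔ ∃ j ∈ A, ∃ k ∈ A, j < k ∧ ∃ I ∈ avail P d j k, m = {(j, I), (k, e j k I)}

/-- A partition, the same for all high-level users `i`, of `Λ i` into parts `Lp j` indexed by the
low-level users `j`, with sub-files in `Lp j` cached by `j` and sizes that differ by at most one. -/
def IsLamPartition (Nh : ℕ) (P : Placement K N) (d : Fin K → Fin N)
    (Lp : Fin K → Finset (Pair K)) : Prop :=
  (∀ i ∈ highUsers Nh d, (lowUsers Nh d).biUnion Lp = Lam Nh P d i ∧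
    ∀ j ∈ lowUsers Nh d, Lp j ⊆ avail P d i j) ∧
  (∀ j ∈ lowUsers Nh d, ∀ k ∈ lowUsers Nh d, j ≠ k → Disjoint (Lp j) (Lp k)) ∧
  ∀ j ∈ lowUsers Nh d, ∀ k ∈ lowUsers Nh d, (Lp j).card ≤ (Lp k).card + 1

/-- Cross-level delivery: for each high-level `i` and low-level `j`, the sub-files in `Fs i j`
(for `i`) are matched one to one with those that `j` needs and `i` caches, and XORed. -/
def IsCrossDelivery (Nh : ℕ) (P : Placement K N) (d : Fin K → Fin N)
    (Fs : Fin K → Fin K → Finset (Pair K)) (D : Finset (Message K)) : Prop :=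
  ∃ g : Fin K → Fin K → Pair K → Pair K,
    (∀ i ∈ highUsers Nh d, ∀ j ∈ lowUsers Nh d,
      Set.BijOn (g i j) (Fs i j : Set (Pair K)) (avail P d j i : Set (Pair K))) ∧
    ∀ m, m ∈ D ↔ ∃ i ∈ highUsers Nh d, ∃ j ∈ lowUsers Nh d, ∃ I ∈ Fs i j,
      m = {(i, I), (j, g i j I)}

/-- Delivery of the sub-files in the sets `Δ i j` to the high-level users: these sub-files are
partitioned into messages, each of which is the XOR of two sub-files for two high-level users that
cache each other's sub-file, except for at most one unicast message. -/
def IsResidualDelivery (Nh : ℕ) (P : Placement K N) (d : Fin K → Fin N)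
    (Δ : Fin K → Fin K → Finset (Pair K)) (D : Finset (Message K)) : Prop :=
  (∀ x, (∃ m ∈ D, x ∈ m) ↔ x.1 ∈ highUsers Nh d ∧ ∃ j ∈ lowUsers Nh d, x.2 ∈ Δ x.1 j) ∧
  (∀ m ∈ D, ∀ m' ∈ D, m ≠ m' → Disjoint m m') ∧
  (∀ m ∈ D, (∃ x, m = {x}) ∨
    ∃ i ∈ highUsers Nh d, ∃ k ∈ highUsers Nh d, i ≠ k ∧
      ∃ I ∈ avail P d i k, ∃ I' ∈ avail P d k i, m = {(i, I), (k, I')}) ∧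
  (D.filter fun m => m.card = 1).card ≤ 1

/-- The four-step delivery phase, used when there are at least two high-level users. -/
def IsFourStepDelivery (Nh : ℕ) (P : Placement K N) (d : Fin K → Fin N)
    (D : Finset (Message K)) : Prop :=
  ∃ D₂ D₃ D₄ : Finset (Message K),
    ∃ (Lp : Fin K → Finset (Pair K)) (Δ : Fin K → Fin K → Finset (Pair K)),
      D = tripleMessages (highUsers Nh d) ∪ D₂ ∪ D₃ ∪ D₄ ∧
      IsLevelOneDelivery P d (lowUsers Nh d) D₂ ∧
      IsLamPartition Nh P d Lp ∧
      (∀ i ∈ highUsers Nh d, ∀ j ∈ lowUsers Nh d, Δ i j ⊆ Omega Nh P d i j) ∧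
      IsCrossDelivery Nh P d (fun i j => Lp j ∪ (Omega Nh P d i j \ Δ i j)) D₃ ∧
      IsResidualDelivery Nh P d Δ D₄

/-- Delivery when there is at most one high-level user: the requested high-level file, if any, is
treated as a low-level file (part of its cached copies is ignored), and level-1 coded delivery is
used for all users. -/
def IsFallbackDelivery (P : Placement K N) (d : Fin K → Fin N) (D : Finset (Message K)) : Prop :=
  ∃ P' : Placement K N, (∀ n I, P' n I ⊆ P n I) ∧ (∀ u, EvenlySplit P' (d u)) ∧
    IsLevelOneDelivery P' d Finset.univ D

/-- The delivery phase of the scheme for the demand vector `d`. -/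
def IsCL21Delivery (Nh : ℕ) (P : Placement K N) (d : Fin K → Fin N)
    (D : Finset (Message K)) : Prop :=
  (2 ≤ (highUsers Nh d).card → IsFourStepDelivery Nh P d D) ∧
    ((highUsers Nh d).card < 2 → IsFallbackDelivery P d D)

/-- The `b` bits sent over the shared link for the message `m`. -/
def transmit {F b : ℕ} (split : Fin F ≃ Pair K × Fin b) (d : Fin K → Fin N) (W : Library N F)
    (m : Message K) : Fin b → ZMod 2 :=
  fun c => ∑ x ∈ m, W (d x.1) (split.symm (x.2, c))

/-- Every user recovers the file it requests from its cache content and the messages in `D`,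
whatever the contents of the library. -/
def Decodable {F b : ℕ} (split : Fin F ≃ Pair K × Fin b) (P : Placement K N) (d : Fin K → Fin N)
    (D : Finset (Message K)) : Prop :=
  ∀ u : Fin K, ∃ ψ : (cachedBits split P u → ZMod 2) → (D → Fin b → ZMod 2) → (Fin F → ZMod 2),
    ∀ W : Library N F,
      ψ (fun x => W x.1.1 x.1.2) (fun m => transmit split d W m.1) = W (d u)

/-- Number of transmitted bits, normalized by the file size. -/
def deliveryRate (F b : ℕ) (D : Finset (Message K)) : ℚ := (D.card * b : ℚ) / F

/-- The expression `L(d)`, in terms of the numbers of high-level and low-level users. -/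
def totalMissing (K kh kl : ℕ) : ℚ := ((K : ℚ) - 1) * ((K : ℚ) ^ 2 / 2 - kh - (kl : ℚ) / 2)

/-- The expression `R(d)`. -/
def cl21Rate (K kh kl : ℕ) : ℚ :=
  if 2 ≤ kh then
    ((kh.choose 3 : ℚ) + (⌈(totalMissing K kh kl - 3 * (kh.choose 3 : ℚ)) / 2⌉ : ℤ)) / K.choose 2
  else ((K : ℚ) - 1) / 2

end CL21

namespace CL21

/-! Write `K = 2q + 1`; each file then has `K * q` sub-files. It suffices that every missing (user,
sub-file) pair lies in exactly one message, where the messages of step (1) serve three users, `p`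
others serve two, and `ε ≤ 1` serve one. Then `2p + ε = L - 3 * C(h, 3)` with `h` high-level users,
and `p + ε` is the ceiling in the rate.

A low-level user needs exactly `q` sub-files from each other user, so low-level users exchange
directly. A high-level user `i` must therefore receive exactly `q` sub-files from each low-level
`j`. A nearly regular tournament on the low-level set `L` (`exists_balanced_owner`) lets `j` supply
the `o j` pairs inside `L` that it owns. Of the `h - 1` mixed pairs `{j, k}` with `k` high-level and
`k ≠ i`, exactly `δ j = h - 1 + o j - q` must then be set aside and obtained from `k` instead.

Setting aside `{j, k}` for `i` is an arc `i → k` of a digraph attached to `j`, with all out-degrees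
equal to `δ j`. Two high-level users can pair what they need from each other when, over all `j`, the
arcs `i → k` and `k → i` are equally numerous. `exists_arcs` achieves this with circulant digraphs,
up to a single arc, which becomes the unicast message. `exists_fourStepDelivery` assembles these
pieces.

With at most one high-level user, a regular tournament on all users selects one cached copy of each
high-level sub-file, and every exchange has size `q` (`exists_fallbackDelivery`). -/

/-! ### Pairs of users and balanced tournaments. -/

/-- Counts the wins of rank `v` in the tournament of `exists_balanced_owner`. The branch `l ≤ v`
serves only the induction on `l`, as long as all ranks counted lie below `v`. -/
lemma card_filter_rank_beats (l v : ℕ) :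
    ((Finset.range l).filter fun b => (b < v ∧ (v - b) % 2 = 0) ∨ (v < b ∧ (b - v) % 2 = 1)).card =
      if l ≤ v then (l + (1 - v % 2)) / 2 else v / 2 + (l - v) / 2 := by
  induction l with
  | zero => simp; omega
  | succ l ih =>
    rw [Finset.range_add_one, Finset.filter_insert]
    split_ifs at ih ⊢ <;>
      first
      | (rw [Finset.card_insert_of_notMem (by simp), ih]; omega)
      | (rw [ih]; omega)

/-- The number of pairs that consist of `u` and an element of `B`. -/
lemma card_filter_pair {K : ℕ} {u : Fin K} {B : Finset (Fin K)} (hu : u ∉ B) :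
    (Finset.univ.filter fun I : Pair K => ∃ v ∈ B, I.1 = {u, v}).card = B.card := by
  symm
  have hne : ∀ v ∈ B, u ≠ v := fun v hv h => hu (h ▸ hv)
  refine Finset.card_bij (fun v hv => ⟨{u, v}, Finset.card_pair (hne v hv)⟩) ?_ ?_ ?_
  · intro v hv
    simp only [Finset.mem_filter, Finset.mem_univ, true_and]
    exact ⟨v, hv, rfl⟩
  · intro v hv v' hv' h
    have h1 : v ∈ ({u, v'} : Finset (Fin K)) := by
      rw [← Subtype.mk.inj h]; simp
    have := hne v hv
    simp only [Finset.mem_insert, Finset.mem_singleton] at h1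
    grind
  · intro I hI
    obtain ⟨v, hv, h⟩ := (Finset.mem_filter.1 hI).2
    exact ⟨v, hv, Subtype.ext h.symm⟩

lemma Pair.eq_of_mem {K : ℕ} (I : Pair K) {u v : Fin K} (hu : u ∈ I.1) (hv : v ∈ I.1)
    (h : u ≠ v) : I.1 = {u, v} := by
  symm
  apply Finset.eq_of_subset_of_card_le
  · intro x hx
    grind
  · rw [I.2, Finset.card_pair h]

lemma Pair.exists_eq_of_mem {K : ℕ} (I : Pair K) {u : Fin K} (hu : u ∈ I.1) :
    ∃ v, v ≠ u ∧ I.1 = {u, v} := by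
  obtain ⟨a, b, hab, h⟩ := Finset.card_eq_two.1 I.2
  rw [h] at hu
  simp only [Finset.mem_insert, Finset.mem_singleton] at hu
  rcases hu with rfl | rfl
  · exact ⟨b, hab.symm, h⟩
  · exact ⟨a, hab, by rw [h, Finset.pair_comm]⟩

/-- Balanced orientation of the complete graph on `L`: every pair inside `L` is owned by one of its
two elements, and the numbers of owned pairs are as equal as possible. -/
lemma exists_balanced_owner {K : ℕ} (L : Finset (Fin K)) :
    ∃ w : Pair K → Fin K, (∀ I : Pair K, I.1 ⊆ L → w I ∈ I.1) ∧
      ∀ j ∈ L, (L.card - 1) / 2 ≤ (Finset.univ.filter fun I : Pair K => I.1 ⊆ L ∧ w I = j).card ∧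
        (Finset.univ.filter fun I : Pair K => I.1 ⊆ L ∧ w I = j).card ≤ L.card / 2 := by
  classical
  let f : Fin K → ℕ := fun v => if h : v ∈ L then (L.equivFin ⟨v, h⟩ : ℕ) else 0
  have hf : ∀ v (h : v ∈ L), f v = (L.equivFin ⟨v, h⟩ : ℕ) := fun v h => by simp [f, h]
  have hinj : ∀ u ∈ L, ∀ v ∈ L, f u = f v → u = v := by
    intro u hu v hv h
    rw [hf u hu, hf v hv] at h
    have := L.equivFin.injective (Fin.ext h)
    exact congrArg Subtype.val this
  have hlt : ∀ v ∈ L, f v < L.card := fun v hv => by rw [hf v hv]; exact Fin.is_lt _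
  have hsurj : ∀ n < L.card, ∃ v ∈ L, f v = n := by
    intro n hn
    refine ⟨(L.equivFin.symm ⟨n, hn⟩).1, (L.equivFin.symm ⟨n, hn⟩).2, ?_⟩
    rw [hf _ (L.equivFin.symm ⟨n, hn⟩).2]
    simp
  -- The higher rank wins at even distance, the lower rank at odd distance. Rank `v` then has about
  -- half of its wins on either side, `v / 2 + (l - v) / 2` in all.
  let beats : Fin K → Fin K → Prop := fun v u =>
    (f u < f v ∧ (f v - f u) % 2 = 0) ∨ (f v < f u ∧ (f u - f v) % 2 = 1)
  have hex : ∀ I : Pair K, ∃ v ∈ I.1, I.1 ⊆ L → ∀ u ∈ I.1, u ≠ v → beats v u := by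
    intro I
    obtain ⟨a, b, hab, h⟩ := Finset.card_eq_two.1 I.2
    by_cases hI : I.1 ⊆ L
    · have ha : a ∈ L := hI (by simp [h])
      have hb : b ∈ L := hI (by simp [h])
      have hne : f a ≠ f b := fun h => hab (hinj a ha b hb h)
      by_cases hbt : beats a b
      · exact ⟨a, by simp [h], fun _ u hu hua => by
          have : u = b := by simp [h] at hu; tauto
          exact this ▸ hbt⟩
      · refine ⟨b, by simp [h], fun _ u hu hua => ?_⟩
        have : u = a := by simp [h] at hu; tauto
        subst this
        simp only [beats] at hbt ⊢
        omega
    · exact ⟨a, by simp [h], fun h => absurd h hI⟩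
  choose w hw hwb using hex
  refine ⟨w, fun I _ => hw I, fun j hj => ?_⟩
  have hcard : (Finset.univ.filter fun I : Pair K => I.1 ⊆ L ∧ w I = j).card =
      ((Finset.range L.card).filter fun b =>
        (b < f j ∧ (f j - b) % 2 = 0) ∨ (f j < b ∧ (b - f j) % 2 = 1)).card := by
    have h1 : (Finset.univ.filter fun I : Pair K => I.1 ⊆ L ∧ w I = j) =
        Finset.univ.filter fun I : Pair K => ∃ v ∈ L.filter (beats j), I.1 = {j, v} := by
      ext I
      simp only [Finset.mem_filter, Finset.mem_univ, true_and]
      constructor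
      · rintro ⟨hI, rfl⟩
        obtain ⟨v, hv, h⟩ := I.exists_eq_of_mem (hw I)
        have hvI : v ∈ I.1 := by rw [h]; simp
        exact ⟨v, ⟨hI hvI, hwb I hI v hvI hv⟩, h⟩
      · rintro ⟨v, ⟨hv, hb⟩, h⟩
        have hI : I.1 ⊆ L := by rw [h]; intro x; grind
        refine ⟨hI, ?_⟩
        by_contra hne
        have h2 := hwb I hI j (by simp [h]) (Ne.symm hne)
        have h3 : w I = v := by
          have := hw I
          simp only [h, Finset.mem_insert, Finset.mem_singleton] at this
          tauto
        rw [h3] at h2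
        simp only [beats] at h2 hb
        omega
    rw [h1, card_filter_pair (by simp [beats])]
    refine Finset.card_bij (fun v _ => f v) ?_ ?_ ?_
    · intro v hv
      simp only [Finset.mem_filter, Finset.mem_range] at hv ⊢
      exact ⟨hlt v hv.1, hv.2⟩
    · intro u hu v hv h
      exact hinj u (Finset.mem_filter.1 hu).1 v (Finset.mem_filter.1 hv).1 h
    · intro n hn
      simp only [Finset.mem_filter, Finset.mem_range] at hn
      obtain ⟨v, hv, rfl⟩ := hsurj n hn.1
      exact ⟨v, Finset.mem_filter.2 ⟨hv, hn.2⟩, rfl⟩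
  rw [hcard, card_filter_rank_beats]
  have := hlt j hj
  rw [if_neg (by omega)]
  omega

/-! ### Families of circulant digraphs with balanced arcs. -/

/-- A set splits into two halves of equal size and at most one further element. -/
lemma exists_halves {ι : Type*} [DecidableEq ι] (J : Finset ι) :
    ∃ A B : Finset ι, A ⊆ J ∧ B ⊆ J ∧ Disjoint A B ∧ A.card = B.card ∧
      ∀ x ∈ J, ∀ y ∈ J, x ∉ A → x ∉ B → y ∉ A → y ∉ B → x = y := by
  obtain ⟨A, hA, hAc⟩ := Finset.exists_subset_card_eq (s := J) (n := J.card / 2) (by omega)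
  obtain ⟨B, hB, hBc⟩ := Finset.exists_subset_card_eq (s := J \ A) (n := J.card / 2)
    (by rw [Finset.card_sdiff_of_subset hA]; omega)
  refine ⟨A, B, hA, hB.trans Finset.sdiff_subset,
    (Finset.disjoint_of_subset_left hB Finset.sdiff_disjoint).symm, by omega, ?_⟩
  have h : ((J \ A) \ B).card ≤ 1 := by
    rw [Finset.card_sdiff_of_subset hB, Finset.card_sdiff_of_subset hA]
    omega
  intro x hx y hy h1 h2 h3 h4
  exact Finset.card_le_one.1 h x (by simp [*]) y (by simp [*])

/-- Symmetric sets of an even number of nonzero residues modulo an odd number. -/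
lemma exists_symmetric_residues {m c : ℕ} [NeZero m] (h : 2 * c + 1 ≤ m) :
    ∃ S : Finset (ZMod m), 0 ∉ S ∧ (∀ s, -s ∈ S ↔ s ∈ S) ∧ S.card = 2 * c ∧
      (0 < c → (1 : ZMod m) ∈ S) := by
  have hinj : Set.InjOn (fun z : ℤ => (z : ZMod m)) (Finset.Icc (-(c : ℤ)) c : Finset ℤ) := by
    intro x hx y hy hxy
    simp only [Finset.coe_Icc, Set.mem_Icc] at hx hy
    have h1 := (ZMod.intCast_eq_intCast_iff_dvd_sub x y m).1 hxy
    have h2 := Int.eq_zero_of_abs_lt_dvd h1 (by rw [abs_lt]; omega)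
    omega
  let S₀ := (Finset.Icc (-(c : ℤ)) c).image fun z : ℤ => (z : ZMod m)
  have hneg : ∀ s, s ∈ S₀ → -s ∈ S₀ := by
    intro s hs
    obtain ⟨z, hz, rfl⟩ := Finset.mem_image.1 hs
    rw [Finset.mem_Icc] at hz
    exact Finset.mem_image.2 ⟨-z, Finset.mem_Icc.2 ⟨by omega, by omega⟩, by push_cast; rfl⟩
  have h0 : (0 : ZMod m) ∈ S₀ :=
    Finset.mem_image.2 ⟨0, Finset.mem_Icc.2 ⟨by omega, by omega⟩, by simp⟩
  refine ⟨S₀.erase 0, by simp, ?_, ?_, ?_⟩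
  · intro s
    simp only [Finset.mem_erase, ne_eq, neg_eq_zero]
    exact and_congr_right fun _ => ⟨fun h => by simpa using hneg _ h, hneg s⟩
  · rw [Finset.card_erase_of_mem h0, Finset.card_image_of_injOn hinj, Int.card_Icc]
    omega
  · intro hc
    have : Fact (1 < m) := ⟨by omega⟩
    exact Finset.mem_erase.2 ⟨one_ne_zero, Finset.mem_image.2
      ⟨1, Finset.mem_Icc.2 ⟨by omega, by omega⟩, by simp⟩⟩

/-- The nonzero even residues modulo an even number. -/
lemma exists_even_residues {m : ℕ} [NeZero m] (h : Even m) :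
    ∃ S : Finset (ZMod m), 0 ∉ S ∧ (∀ s, -s ∈ S ↔ s ∈ S) ∧ S.card = m / 2 - 1 := by
  let S₀ := (Finset.range (m / 2)).image fun n : ℕ => ((2 * n : ℕ) : ZMod m)
  have hm : 0 < m := NeZero.pos m
  obtain ⟨r, rfl⟩ := h
  have hinj : Set.InjOn (fun n : ℕ => ((2 * n : ℕ) : ZMod (r + r)))
      (Finset.range ((r + r) / 2) : Finset ℕ) := by
    intro x hx y hy hxy
    simp only [Finset.coe_range, Set.mem_Iio] at hx hy
    have h1 := (ZMod.natCast_eq_natCast_iff _ _ _).1 hxy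
    have := Nat.ModEq.eq_of_lt_of_lt h1 (by omega) (by omega)
    omega
  have hneg : ∀ s, s ∈ S₀ → -s ∈ S₀ := by
    intro s hs
    obtain ⟨n, hn, rfl⟩ := Finset.mem_image.1 hs
    rw [Finset.mem_range] at hn
    rcases Nat.eq_zero_or_pos n with rfl | hpos
    · simpa using hs
    · refine Finset.mem_image.2 ⟨r - n, Finset.mem_range.2 (by omega), ?_⟩
      rw [eq_neg_iff_add_eq_zero, ← Nat.cast_add, show 2 * (r - n) + 2 * n = r + r by omega]
      exact ZMod.natCast_self _
  have h0 : (0 : ZMod (r + r)) ∈ S₀ :=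
    Finset.mem_image.2 ⟨0, Finset.mem_range.2 (by omega), by simp⟩
  refine ⟨S₀.erase 0, by simp, ?_, ?_⟩
  · intro s
    simp only [Finset.mem_erase, ne_eq, neg_eq_zero]
    exact and_congr_right fun _ => ⟨fun h => by simpa using hneg _ h, hneg s⟩
  · rw [Finset.card_erase_of_mem h0, Finset.card_image_of_injOn hinj, Finset.card_range]

/-- Near-perfect matching of consecutive residues modulo an odd number: `ρ` is an involution away
from the residue `-1`, which it sends to `0`. -/
lemma exists_near_matching {m : ℕ} (hm : Odd m) (h1 : 1 < m) :
    ∃ ρ : ZMod m → ZMod m, (∀ i, ρ i = i + 1 ∨ ρ i = i - 1) ∧ ρ (-1) = 0 ∧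
      ∀ i, i ≠ -1 → ρ (ρ i) = i := by
  have : NeZero m := ⟨by omega⟩
  have : Fact (1 < m) := ⟨h1⟩
  have hv1 : (-1 : ZMod m).val = m - 1 := by
    rw [ZMod.neg_val, if_neg one_ne_zero, ZMod.val_one]
  -- Residues `2s` and `2s + 1` are swapped; as `m` is odd, the last residue `m - 1` has no partner.
  refine ⟨fun i => if i = -1 then 0 else if i.val % 2 = 0 then i + 1 else i - 1, ?_, ?_, ?_⟩
  · intro i
    dsimp only
    split_ifs with h <;> simp [h]
  · simp
  · intro i hi
    have hlt : i.val + 1 < m := by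
      have h2 := ZMod.val_lt i
      have h3 : i.val ≠ m - 1 := fun h => hi (ZMod.val_injective m (by rw [h, hv1]))
      omega
    obtain ⟨r, hr⟩ := hm
    have hs : (i + 1).val = i.val + 1 := by
      rw [ZMod.val_add_of_lt (by rw [ZMod.val_one]; omega), ZMod.val_one]
    by_cases hp : i.val % 2 = 0
    · have h2 : i + 1 ≠ -1 := by
        intro h
        rw [h, hv1] at hs
        omega
      simp only [if_neg hi, if_pos hp, if_neg h2]
      rw [if_neg (by omega)]
      ring
    · have hs' : (i - 1).val = i.val - 1 := by
        rw [ZMod.val_sub (by rw [ZMod.val_one]; omega), ZMod.val_one]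
      have h2 : i - 1 ≠ -1 := by
        intro h
        rw [h, hv1] at hs'
        omega
      simp only [if_neg hi, if_neg hp, if_neg h2]
      rw [if_pos (by omega)]
      ring

lemma card_filter_sub_mem {m : ℕ} [NeZero m] (S : Finset (ZMod m)) (i : ZMod m) :
    (Finset.univ.filter fun k => k - i ∈ S).card = S.card := by
  refine Finset.card_bij (fun k _ => k - i) (by simp) (by simp) fun s hs => ⟨s + i, by simpa, by simp⟩

/-- Circulant families of out-regular digraphs with prescribed out-degrees `δ j` such that, after
removal of at most one arc `U ⊆ T` of the whole family, every arc occurs as often as its reverse. -/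
lemma exists_arcs_zmod {ι : Type*} [DecidableEq ι] (J : Finset ι) (δ : ι → ℕ) (m : ℕ) [NeZero m]
    (h : (Odd m ∧ ∀ j ∈ J, δ j ≤ m - 1) ∨ (Even m ∧ ∀ j ∈ J, δ j = m / 2 - 1)) :
    ∃ T U : ι → ZMod m → Finset (ZMod m),
      (∀ j ∈ J, ∀ i, i ∉ T j i ∧ (T j i).card = δ j ∧ U j i ⊆ T j i) ∧
      (∀ i k, (J.filter fun j => k ∈ U j i).card = (J.filter fun j => i ∈ U j k).card) ∧
      ∀ j ∈ J, ∀ j' ∈ J, ∀ i k i' k', k ∈ T j i → k ∉ U j i → k' ∈ T j' i' → k' ∉ U j' i' →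
        j = j' ∧ i = i' ∧ k = k' := by
  have hsymm : ∀ S : Finset (ZMod m), (∀ s, -s ∈ S ↔ s ∈ S) → ∀ i k, k - i ∈ S ↔ i - k ∈ S := by
    intro S hS i k
    rw [← hS, neg_sub]
  rcases h with ⟨hm, hδ⟩ | ⟨hm, hδ⟩
  -- The symmetric connection set has size `δ j` rounded up to an even number. This still fits into
  -- the nonzero residues because `m - 1` is even.
  · have hex : ∀ j, ∃ S : Finset (ZMod m), j ∈ J → 0 ∉ S ∧ (∀ s, -s ∈ S ↔ s ∈ S) ∧
        S.card = 2 * ((δ j + 1) / 2) ∧ (0 < (δ j + 1) / 2 → (1 : ZMod m) ∈ S) := by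
      intro j
      by_cases hj : j ∈ J
      · obtain ⟨S, hS⟩ := exists_symmetric_residues (m := m) (c := (δ j + 1) / 2)
          (by obtain ⟨r, hr⟩ := hm; have := hδ j hj; omega)
        exact ⟨S, fun _ => hS⟩
      · exact ⟨∅, fun h => absurd h hj⟩
    choose S hS using hex
    by_cases hm1 : m = 1
    · subst hm1
      refine ⟨fun _ _ => ∅, fun _ _ => ∅, ?_, by simp, by simp⟩
      intro j hj i
      have := hδ j hj
      simp; omega
    obtain ⟨ρ, hρ, hρ1, hρi⟩ := exists_near_matching hm (by have := NeZero.pos m; omega)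
    have : Fact (1 < m) := ⟨by have := NeZero.pos m; omega⟩
    have h2 : (2 : ZMod m) ≠ 0 := by
      intro h
      have := (ZMod.natCast_eq_zero_iff 2 m).1 (by exact_mod_cast h)
      have := Nat.le_of_dvd (by norm_num) this
      obtain ⟨r, hr⟩ := hm
      omega
    -- For odd `δ j` one arc too many leaves each vertex. Deleting `i → i + 1` for `j ∈ A` and `i →
    -- i - 1` for `j ∈ B` cancels over the family since the halves are equally large; at most one
    -- index remains.
    obtain ⟨A, B, hA, hB, hAB, hc, hsub⟩ := exists_halves (J.filter fun j => δ j % 2 = 1)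
    have hA' : ∀ j ∈ A, j ∈ J ∧ δ j % 2 = 1 := fun j hj => Finset.mem_filter.1 (hA hj)
    have hB' : ∀ j ∈ B, j ∈ J ∧ δ j % 2 = 1 := fun j hj => Finset.mem_filter.1 (hB hj)
    let E : ι → Prop := fun j => δ j % 2 = 1 ∧ j ∉ A ∧ j ∉ B
    -- `σ j i` is the head of the arc deleted at `i`. For even `δ j` it is `i` itself, and nothing
    -- is deleted because `0 ∉ S j`.
    let σ : ι → ZMod m → ZMod m := fun j i =>
      if j ∈ A then i + 1 else if j ∈ B then i - 1 else if δ j % 2 = 1 then ρ i else i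
    have hσ : ∀ j i, δ j % 2 = 1 → σ j i = i + 1 ∨ σ j i = i - 1 := by
      intro j i hj
      simp only [σ]
      split_ifs <;> simp [hρ]
    have hσ0 : ∀ j i, δ j % 2 ≠ 1 → σ j i = i := by
      intro j i hj
      have h1 : j ∉ A := fun h => hj (hA' j h).2
      have h2 : j ∉ B := fun h => hj (hB' j h).2
      simp [σ, h1, h2, hj]
    have hone : ∀ j ∈ J, δ j % 2 = 1 → (1 : ZMod m) ∈ S j ∧ (-1 : ZMod m) ∈ S j := by
      intro j hj h
      have h1 := (hS j hj).2.2.2 (by omega)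
      exact ⟨h1, ((hS j hj).2.1 1).2 h1⟩
    classical
    let T : ι → ZMod m → Finset (ZMod m) := fun j i =>
      (Finset.univ.filter fun k => k - i ∈ S j).erase (σ j i)
    -- For the remaining index the deletions follow `ρ`, an involution except that `-1` goes to `0`.
    -- Only the arc `0 → -1` can be left without its reverse, so it is excluded from `U`.
    let U : ι → ZMod m → Finset (ZMod m) := fun j i =>
      (T j i).filter fun k => ¬(E j ∧ i = 0 ∧ k = -1)
    have hT : ∀ j i k, k ∈ T j i ↔ k ≠ σ j i ∧ k - i ∈ S j := by
      intro j i k; simp [T]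
    have hU : ∀ j i k, k ∈ U j i ↔ (k ≠ σ j i ∧ k - i ∈ S j) ∧ ¬(E j ∧ i = 0 ∧ k = -1) := by
      intro j i k; simp only [U, Finset.mem_filter, hT]
    refine ⟨T, U, ?_, ?_, ?_⟩
    · intro j hj i
      refine ⟨?_, ?_, Finset.filter_subset _ _⟩
      · rw [hT, sub_self]
        exact fun h => (hS j hj).1 h.2
      · by_cases hp : δ j % 2 = 1
        · have hmem : σ j i ∈ Finset.univ.filter fun k => k - i ∈ S j := by
            have := hone j hj hp
            rcases hσ j i hp with h | h <;> simp [h, this]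
          simp only [T]
          rw [Finset.card_erase_of_mem hmem, card_filter_sub_mem, (hS j hj).2.2.1]
          omega
        · have hmem : σ j i ∉ Finset.univ.filter fun k => k - i ∈ S j := by
            rw [hσ0 j i hp]
            simpa using (hS j hj).1
          simp only [T]
          rw [Finset.erase_eq_of_notMem hmem, card_filter_sub_mem, (hS j hj).2.2.1]
          omega
    · have hrest : ∀ j ∈ J, j ∉ A → j ∉ B → ∀ i k, k ∈ U j i → i ∈ U j k := by
        intro j hj hjA hjB i k hk
        rw [hU] at hk ⊢
        obtain ⟨⟨h1, h2⟩, h3⟩ := hk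
        refine ⟨⟨?_, (hsymm _ (hS j hj).2.1 _ _).1 h2⟩, ?_⟩
        · by_cases hp : δ j % 2 = 1
          · simp only [σ, hjA, hjB, hp, if_true, if_false] at h1 ⊢
            rintro rfl
            by_cases hk : k = -1
            · subst hk
              exact h3 ⟨⟨hp, hjA, hjB⟩, hρ1, rfl⟩
            · exact h1 (hρi k hk).symm
          · rw [hσ0 j _ hp] at h1 ⊢
            exact h1.symm
        · rintro ⟨hE, rfl, rfl⟩
          simp only [σ, hjA, hjB, hE.1, if_true, if_false] at h1
          exact h1 hρ1.symm
      have hUA : ∀ j ∈ A, ∀ i k, k ∈ U j i ↔ k ≠ i + 1 ∧ k - i ∈ S j := by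
        intro j hj i k
        simp [hU, E, hj, σ]
      have hUB : ∀ j ∈ B, ∀ i k, k ∈ U j i ↔ k ≠ i - 1 ∧ k - i ∈ S j := by
        intro j hj i k
        have : j ∉ A := fun h => Finset.disjoint_left.1 hAB h hj
        simp [hU, E, hj, this, σ]
      have hsplit : ∀ i k, (J.filter fun j => k ∈ U j i).card =
          (((J \ A) \ B).filter fun j => k ∈ U j i).card +
            ((A.filter fun j => k ∈ U j i).card + (B.filter fun j => k ∈ U j i).card) := by
        intro i k
        have hJ : J = ((J \ A) \ B) ∪ (A ∪ B) := by
          ext x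
          simp only [Finset.mem_union, Finset.mem_sdiff]
          have := fun h => (hA' x h).1
          have := fun h => (hB' x h).1
          tauto
        conv_lhs => rw [hJ]
        rw [Finset.filter_union, Finset.filter_union, Finset.card_union_of_disjoint,
          Finset.card_union_of_disjoint]
        · exact Finset.disjoint_filter_filter hAB
        · rw [← Finset.filter_union]
          apply Finset.disjoint_filter_filter
          rw [Finset.disjoint_left]
          intro x
          simp only [Finset.mem_union, Finset.mem_sdiff]
          tauto
      have hAB' : ∀ i k, (A.filter fun j => k ∈ U j i).card + (B.filter fun j => k ∈ U j i).card =
          (A.filter fun j => i ∈ U j k).card + (B.filter fun j => i ∈ U j k).card := by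
        -- The arc `i → i + 1` is missing for all of `A` and present for all of `B`; for its reverse
        -- the roles are exchanged. Both counts are therefore the common size of `A` and `B`.
        have key : ∀ i k, k = i + 1 →
            (A.filter fun j => k ∈ U j i).card + (B.filter fun j => k ∈ U j i).card =
            (A.filter fun j => i ∈ U j k).card + (B.filter fun j => i ∈ U j k).card := by
          rintro i k rfl
          have h11 : i ≠ i + 1 + 1 := by
            intro h
            apply h2
            have : i + 0 = i + (1 + 1) := by rw [← add_assoc, ← h, add_zero]
            have := add_left_cancel this
            rw [← one_add_one_eq_two, ← this]
          have h12 : i + 1 ≠ i - 1 := by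
            intro h
            apply h11
            rw [h]; ring
          rw [Finset.filter_false_of_mem (s := A) (p := fun j => i + 1 ∈ U j i),
            Finset.filter_true_of_mem (s := B) (p := fun j => i + 1 ∈ U j i),
            Finset.filter_true_of_mem (s := A) (p := fun j => i ∈ U j (i + 1)),
            Finset.filter_false_of_mem (s := B) (p := fun j => i ∈ U j (i + 1))]
          · simp [hc]
          · intro j hj
            simp [hUB j hj]
          · intro j hj
            rw [hUA j hj]
            refine ⟨h11, ?_⟩
            rw [show i - (i + 1) = -1 by ring]
            exact (hone j (hA' j hj).1 (hA' j hj).2).2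
          · intro j hj
            rw [hUB j hj]
            refine ⟨h12, ?_⟩
            rw [show i + 1 - i = 1 by ring]
            exact (hone j (hB' j hj).1 (hB' j hj).2).1
          · intro j hj
            simp [hUA j hj]
        intro i k
        by_cases h1 : k = i + 1
        · exact key i k h1
        by_cases h2 : i = k + 1
        · exact (key k i h2).symm
        have e1 : k ≠ i - 1 := fun h => h2 (by rw [h]; ring)
        have e2 : i ≠ k - 1 := fun h => h1 (by rw [h]; ring)
        congr 1
        · congr 1
          apply Finset.filter_congr
          intro j hj
          simp only [hUA j hj, ne_eq, h1, h2, not_false_eq_true, true_and]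
          exact hsymm _ (hS j (hA' j hj).1).2.1 _ _
        · congr 1
          apply Finset.filter_congr
          intro j hj
          simp only [hUB j hj, ne_eq, e1, e2, not_false_eq_true, true_and]
          exact hsymm _ (hS j (hB' j hj).1).2.1 _ _
      intro i k
      rw [hsplit, hsplit k i, hAB' i k]
      congr 2
      apply Finset.filter_congr
      intro j hj
      simp only [Finset.mem_sdiff] at hj
      exact ⟨hrest j hj.1.1 hj.1.2 hj.2 i k, hrest j hj.1.1 hj.1.2 hj.2 k i⟩
    · intro j hj j' hj' i k i' k' h1 h2 h3 h4
      simp only [U, Finset.mem_filter, h1, h3, true_and, not_not] at h2 h4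
      obtain ⟨h2, rfl, rfl⟩ := h2
      obtain ⟨h4, rfl, rfl⟩ := h4
      exact ⟨hsub j (Finset.mem_filter.2 ⟨hj, h2.1⟩) j' (Finset.mem_filter.2 ⟨hj', h4.1⟩)
        h2.2.1 h2.2.2 h4.2.1 h4.2.2, rfl, rfl⟩
  -- The nonzero even residues form a symmetric set of the exact size, even when that size is odd:
  -- then the self-inverse residue `m / 2` is among them. No arc has to be removed.
  · obtain ⟨S, hS0, hSs, hSc⟩ := exists_even_residues hm
    refine ⟨fun _ i => Finset.univ.filter fun k => k - i ∈ S,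
      fun _ i => Finset.univ.filter fun k => k - i ∈ S, ?_, ?_, ?_⟩
    · intro j hj i
      refine ⟨by simpa using hS0, ?_, subset_rfl⟩
      rw [card_filter_sub_mem, hSc, hδ j hj]
    · intro i k
      simp only [Finset.mem_filter, Finset.mem_univ, true_and, hsymm S hSs i k]
    · intro j _ j' _ i k i' k' h1 h2
      exact absurd h1 h2

/-- The digraphs of `exists_arcs_zmod` on an arbitrary finite set of vertices. -/
lemma exists_arcs {ι α : Type*} [DecidableEq ι] [DecidableEq α] (J : Finset ι) (H : Finset α)
    (δ : ι → ℕ) (hH : H.Nonempty)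
    (h : (Odd H.card ∧ ∀ j ∈ J, δ j ≤ H.card - 1) ∨
      (Even H.card ∧ ∀ j ∈ J, δ j = H.card / 2 - 1)) :
    ∃ T U : ι → α → Finset α,
      (∀ j ∈ J, ∀ i ∈ H, T j i ⊆ H.erase i ∧ (T j i).card = δ j ∧ U j i ⊆ T j i) ∧
      (∀ i ∈ H, ∀ k ∈ H,
        (J.filter fun j => k ∈ U j i).card = (J.filter fun j => i ∈ U j k).card) ∧
      ∀ j ∈ J, ∀ j' ∈ J, ∀ i ∈ H, ∀ i' ∈ H, ∀ k k', k ∈ T j i → k ∉ U j i → k' ∈ T j' i' →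
        k' ∉ U j' i' → j = j' ∧ i = i' ∧ k = k' := by
  have : NeZero H.card := ⟨hH.card_pos.ne'⟩
  obtain ⟨T, U, h1, h2, h3⟩ := exists_arcs_zmod J δ H.card h
  let e : H ≃ ZMod H.card := Fintype.equivOfCardEq (by rw [ZMod.card, Fintype.card_coe])
  let f : α → ZMod H.card := fun i => if hi : i ∈ H then e ⟨i, hi⟩ else 0
  have hf : ∀ i (hi : i ∈ H), f i = e ⟨i, hi⟩ := fun i hi => by simp [f, hi]
  have hinj : ∀ i ∈ H, ∀ k ∈ H, f i = f k → i = k := by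
    intro i hi k hk h
    rw [hf i hi, hf k hk] at h
    exact congrArg Subtype.val (e.injective h)
  refine ⟨fun j i => H.filter fun k => f k ∈ T j (f i),
    fun j i => H.filter fun k => f k ∈ U j (f i), ?_, ?_, ?_⟩
  · intro j hj i hi
    obtain ⟨g1, g2, g3⟩ := h1 j hj (f i)
    refine ⟨?_, ?_, ?_⟩
    · intro k hk
      rw [Finset.mem_filter] at hk
      refine Finset.mem_erase.2 ⟨?_, hk.1⟩
      rintro rfl
      exact g1 hk.2
    · rw [← g2]
      refine Finset.card_bij (fun k _ => f k) ?_ ?_ ?_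
      · intro k hk
        exact (Finset.mem_filter.1 hk).2
      · intro k hk k' hk' h
        exact hinj k (Finset.mem_filter.1 hk).1 k' (Finset.mem_filter.1 hk').1 h
      · intro x hx
        have hfx : f (e.symm x).1 = x := by rw [hf _ (e.symm x).2]; simp
        exact ⟨(e.symm x).1, Finset.mem_filter.2 ⟨(e.symm x).2, by rwa [hfx]⟩, hfx⟩
    · intro k hk
      rw [Finset.mem_filter] at hk ⊢
      exact ⟨hk.1, g3 hk.2⟩
  · intro i hi k hk
    simp only [Finset.mem_filter, hi, hk, true_and]
    exact h2 (f i) (f k)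
  · intro j hj j' hj' i hi i' hi' k k' hk hk' g g'
    simp only [Finset.mem_filter, not_and] at hk hk' g g'
    obtain ⟨a, b, c⟩ := h3 j hj j' hj' (f i) (f k) (f i') (f k') hk.2 (hk' hk.1) g.2 (g' g.1)
    exact ⟨a, hinj i hi i' hi' b, hinj k hk.1 k' g.1 c⟩

/-! ### Counting cached and missing sub-files. -/

variable {K N : ℕ}

lemma eq_two_mul_add_one_of_dvd_choose (hK : 2 ≤ K) (hdiv : K ∣ K.choose 2) :
    ∃ q, K = 2 * q + 1 ∧ K.choose 2 = K * q := by
  obtain ⟨q, hq⟩ := hdiv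
  refine ⟨q, ?_, hq⟩
  have h1 := Nat.add_one_mul_choose_eq (K - 1) 1
  rw [Nat.choose_one_right, show K - 1 + 1 = K by omega, hq] at h1
  have h2 : K * (K - 1) = K * (2 * q) := by rw [h1]; ring
  have := Nat.eq_of_mul_eq_mul_left (by omega) h2
  omega

lemma card_pair_univ : (Finset.univ : Finset (Pair K)).card = K.choose 2 := by
  rw [Finset.card_univ, Fintype.card_finset_len, Fintype.card_fin]

lemma card_filter_mem_pair (u : Fin K) :
    (Finset.univ.filter fun I : Pair K => u ∈ I.1).card = K - 1 := by
  have h : (Finset.univ.filter fun I : Pair K => u ∈ I.1) =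
      Finset.univ.filter fun I : Pair K => ∃ v ∈ Finset.univ.erase u, I.1 = {u, v} := by
    ext I
    simp only [Finset.mem_filter, Finset.mem_univ, true_and, Finset.mem_erase, and_true]
    exact ⟨I.exists_eq_of_mem, fun ⟨v, _, h⟩ => by simp [h]⟩
  rw [h, card_filter_pair (by simp), Finset.card_erase_of_mem (by simp), Finset.card_univ,
    Fintype.card_fin]

lemma card_filter_pair_subset (B : Finset (Fin K)) :
    (Finset.univ.filter fun I : Pair K => I.1 ⊆ B).card = B.card.choose 2 := by
  rw [← Finset.card_powersetCard]
  refine Finset.card_bij (fun I _ => I.1) ?_ ?_ ?_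
  · intro I hI
    exact Finset.mem_powersetCard.2 ⟨(Finset.mem_filter.1 hI).2, I.2⟩
  · intro I _ I' _ h
    exact Subtype.ext h
  · intro I hI
    obtain ⟨h1, h2⟩ := Finset.mem_powersetCard.1 hI
    exact ⟨⟨I, h2⟩, by simpa using h1, rfl⟩

/-- With an odd number of users, every pair of users can be owned by one of its elements so that all
users own equally many pairs. -/
lemma exists_even_owner {q : ℕ} (hq : K = 2 * q + 1) :
    ∃ w : Pair K → Fin K, (∀ I : Pair K, w I ∈ I.1) ∧
      ∀ u, (Finset.univ.filter fun I : Pair K => w I = u).card = q := by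
  obtain ⟨w, h1, h2⟩ := exists_balanced_owner (Finset.univ : Finset (Fin K))
  refine ⟨w, fun I => h1 I (Finset.subset_univ _), fun u => ?_⟩
  have := h2 u (Finset.mem_univ _)
  simp only [Finset.subset_univ, true_and, Finset.card_univ, Fintype.card_fin] at this
  omega

lemma EvenlySplit.card_eq {P : Placement K N} {n : Fin N} (h : EvenlySplit P n) {q : ℕ}
    (hc : K.choose 2 = K * q) (u : Fin K) :
    (Finset.univ.filter fun I : Pair K => u ∈ P n I).card = q := by
  have h1 := h.2 u
  rw [hc] at h1
  exact Nat.eq_of_mul_eq_mul_left u.pos h1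

lemma evenlySplit_owner {P : Placement K N} {n : Fin N} {w : Pair K → Fin K} {q : ℕ}
    (hc : K.choose 2 = K * q) (hP : ∀ I, P n I = {w I})
    (hw : ∀ u, (Finset.univ.filter fun I : Pair K => w I = u).card = q) : EvenlySplit P n := by
  refine ⟨fun I => by simp [hP], fun u => ?_⟩
  rw [hc, ← hw u]
  congr 2
  ext I
  simp [hP, eq_comm]

lemma exists_isCL21Placement {q : ℕ} (hq : K = 2 * q + 1) (hc : K.choose 2 = K * q) (Nh : ℕ) :
    ∃ P : Placement K N, IsCL21Placement Nh P := by
  obtain ⟨w, -, hw⟩ := exists_even_owner hq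
  refine ⟨fun n I => if n.val < Nh then I.1 else {w I}, fun n hn I => by simp [hn], fun n hn => ?_⟩
  exact evenlySplit_owner hc (fun I => by simp [Nat.not_lt.2 hn]) hw

lemma card_file_eq {F b : ℕ} (split : Fin F ≃ Pair K × Fin b) : F = K.choose 2 * b := by
  have h := Fintype.card_congr split
  rwa [Fintype.card_fin, Fintype.card_prod, Fintype.card_fin, ← Finset.card_univ,
    card_pair_univ] at h

lemma card_filter_split {F b : ℕ} (split : Fin F ≃ Pair K × Fin b) (p : Pair K → Prop)
    [DecidablePred p] :
    (Finset.univ.filter fun x : Fin F => p (split x).1).card =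
      (Finset.univ.filter p).card * b := by
  have h : (Finset.univ.filter p).card * b =
      ((Finset.univ.filter p) ×ˢ (Finset.univ : Finset (Fin b))).card := by
    rw [Finset.card_product, Finset.card_univ, Fintype.card_fin]
  rw [h]
  refine Finset.card_bij (fun x _ => split x) ?_ ?_ ?_
  · intro x hx
    simpa using hx
  · intro x _ y _ h
    exact split.injective h
  · intro y hy
    exact ⟨split.symm y, by simpa using hy, by simp⟩

lemma card_cached {P : Placement K N} {Nh q : ℕ} (hq : K = 2 * q + 1) (hc : K.choose 2 = K * q)
    (hP : IsCL21Placement Nh P) (u : Fin K) (n : Fin N) :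
    (Finset.univ.filter fun I : Pair K => u ∈ P n I).card = if n.val < Nh then 2 * q else q := by
  split_ifs with h
  · simp only [hP.1 n h, card_filter_mem_pair]
    omega
  · exact (hP.2 n (by omega)).card_eq hc u

/-- A user holds `2q` sub-files of a high-level file and `q` of a low-level one, that is, `q` per
file plus `q` more per high-level file. -/
lemma card_cachedBits {F b Nh q : ℕ} (hq : K = 2 * q + 1) (hc : K.choose 2 = K * q) (hN : Nh ≤ N)
    (split : Fin F ≃ Pair K × Fin b) {P : Placement K N} (hP : IsCL21Placement Nh P) (u : Fin K) :
    (cachedBits split P u).card = (Nh + N) * q * b := by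
  have h1 : (cachedBits split P u).card =
      ∑ n : Fin N, (Finset.univ.filter fun x : Fin F => u ∈ P n (split x).1).card := by
    rw [cachedBits, Finset.card_filter, Fintype.sum_prod_type]
    simp only [Finset.card_filter]
  have h2 : ∀ n : Fin N, (Finset.univ.filter fun x : Fin F => u ∈ P n (split x).1).card =
      (if n.val < Nh then q * b else 0) + q * b := by
    intro n
    rw [card_filter_split split (fun I => u ∈ P n I), card_cached hq hc hP]
    split_ifs <;> ring
  have h3 : (Finset.univ.filter fun n : Fin N => n.val < Nh).card = Nh := by
    rw [Fin.card_filter_val_lt, min_eq_right hN]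
  rw [h1, Finset.sum_congr rfl fun n _ => h2 n, Finset.sum_add_distrib, ← Finset.sum_filter,
    Finset.sum_const, Finset.sum_const, h3, Finset.card_univ, Fintype.card_fin]
  simp only [smul_eq_mul]
  ring

lemma card_missing {P : Placement K N} {Nh q : ℕ} (hq : K = 2 * q + 1) (hc : K.choose 2 = K * q)
    (hP : IsCL21Placement Nh P) (d : Fin K → Fin N) (u : Fin K) :
    (missing P d u).card + (if u ∈ highUsers Nh d then 2 * q else q) = K * q := by
  have h := Finset.card_filter_add_card_filter_not (s := (Finset.univ : Finset (Pair K)))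
    (fun I => u ∈ P (d u) I)
  rw [card_pair_univ, hc, card_cached hq hc hP] at h
  simp only [highUsers, Finset.mem_filter, Finset.mem_univ, true_and, missing]
  omega

lemma card_highUsers_add_card_lowUsers (Nh : ℕ) (d : Fin K → Fin N) :
    (highUsers Nh d).card + (lowUsers Nh d).card = K := by
  have h := Finset.card_filter_add_card_filter_not (s := (Finset.univ : Finset (Fin K)))
    (fun u => (d u).val < Nh)
  simp only [not_lt] at h
  rw [highUsers, lowUsers, h, Finset.card_univ, Fintype.card_fin]

lemma sum_card_missing {P : Placement K N} {Nh q : ℕ} (hq : K = 2 * q + 1)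
    (hc : K.choose 2 = K * q) (hP : IsCL21Placement Nh P) (d : Fin K → Fin N) :
    ((∑ u : Fin K, (missing P d u).card : ℕ) : ℚ) =
      totalMissing K (highUsers Nh d).card (lowUsers Nh d).card := by
  have h1 : ∑ u : Fin K, (missing P d u).card +
      ((highUsers Nh d).card * q + K * q) = K * (K * q) := by
    have h := Finset.sum_congr rfl fun u (_ : u ∈ Finset.univ) => card_missing hq hc hP d u
    rw [Finset.sum_add_distrib, Finset.sum_const, Finset.card_univ, Fintype.card_fin,
      smul_eq_mul] at h
    rw [← h]
    congr 1
    have h2 : ∀ u, (if u ∈ highUsers Nh d then 2 * q else q) =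
        (if u ∈ highUsers Nh d then q else 0) + q := by
      intro u; split_ifs <;> ring
    rw [Finset.sum_congr rfl fun u _ => h2 u, Finset.sum_add_distrib, Finset.sum_const,
      Finset.card_univ, Fintype.card_fin, smul_eq_mul, ← Finset.sum_filter, Finset.sum_const,
      smul_eq_mul]
    simp
  have h2 := card_highUsers_add_card_lowUsers Nh d
  have h1' : ((∑ u : Fin K, (missing P d u).card : ℕ) : ℚ) +
      ((highUsers Nh d).card * q + K * q) = K * (K * q) := by exact_mod_cast h1
  have h2' : ((highUsers Nh d).card : ℚ) + (lowUsers Nh d).card = K := by exact_mod_cast h2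
  have hq' : (K : ℚ) = 2 * q + 1 := by exact_mod_cast hq
  have hq'' : (q : ℚ) = ((K : ℚ) - 1) / 2 := by rw [hq']; ring
  have h3 : ((lowUsers Nh d).card : ℚ) = K - (highUsers Nh d).card := by rw [← h2']; ring
  rw [totalMissing, eq_sub_of_add_eq h1', h3, hq'']
  ring

/-! ### Decoding criterion. -/

/-- A sub-file can be decoded from a message if all other sub-files in the message are cached. -/
lemma decodable_of_forall_missing {F b : ℕ} (split : Fin F ≃ Pair K × Fin b) (P : Placement K N)
    (d : Fin K → Fin N) (D : Finset (Message K))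
    (h : ∀ u I, u ∉ P (d u) I →
      ∃ m ∈ D, (u, I) ∈ m ∧ ∀ x ∈ m, x ≠ (u, I) → u ∈ P (d x.1) x.2) :
    Decodable split P d D := by
  intro u
  let obs : Library N F → (cachedBits split P u → ZMod 2) × (D → Fin b → ZMod 2) :=
    fun W => (fun x => W x.1.1 x.1.2, fun m => transmit split d W m.1)
  -- Decodability means that what the user observes determines its file; no explicit decoder is
  -- needed.
  have hfac : Function.FactorsThrough (fun W : Library N F => W (d u)) obs := by
    intro W W' hW
    have hcache : ∀ n y, u ∈ P n (split y).1 → W n y = W' n y := by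
      intro n y hy
      exact congrFun (congrArg Prod.fst hW) ⟨(n, y), by simpa [cachedBits] using hy⟩
    funext y
    by_cases hy : u ∈ P (d u) (split y).1
    · exact hcache _ _ hy
    · obtain ⟨m, hm, hmem, hrest⟩ := h u _ hy
      have ht := congrFun (congrFun (congrArg Prod.snd hW) ⟨m, hm⟩) (split y).2
      simp only [obs, transmit] at ht
      rw [← Finset.add_sum_erase m _ hmem, ← Finset.add_sum_erase m _ hmem] at ht
      have hsum : ∑ x ∈ m.erase (u, (split y).1), W (d x.1) (split.symm (x.2, (split y).2)) =
          ∑ x ∈ m.erase (u, (split y).1), W' (d x.1) (split.symm (x.2, (split y).2)) := by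
        refine Finset.sum_congr rfl fun x hx => hcache _ _ ?_
        rw [Finset.mem_erase] at hx
        simpa using hrest x hx.2 hx.1
      rw [hsum] at ht
      simpa using add_right_cancel ht
  -- The value `0` is used only on observations that no library produces.
  refine ⟨fun c t => Function.extend obs (fun W => W (d u)) (fun _ _ => 0) (c, t), fun W => ?_⟩
  exact hfac.extend_apply (fun _ _ => 0) W

/-! ### Messages that serve two users. -/

/-- Messages that combine, for each `u, v` with `R u v`, the sub-files in `A u v` for `u` with
those in `A v u` for `v`, matched by `e u v`. -/
def pairing (R : Fin K → Fin K → Prop) [DecidableRel R] (A : Fin K → Fin K → Finset (Pair K))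
    (e : Fin K → Fin K → Pair K → Pair K) : Finset (Message K) :=
  (Finset.univ.filter fun x : Fin K × Fin K => R x.1 x.2).biUnion fun x =>
    (A x.1 x.2).image fun I => {(x.1, I), (x.2, e x.1 x.2 I)}

lemma mem_pairing {R : Fin K → Fin K → Prop} [DecidableRel R]
    {A : Fin K → Fin K → Finset (Pair K)} {e : Fin K → Fin K → Pair K → Pair K} {m : Message K} :
    m ∈ pairing R A e ↔ ∃ u v, R u v ∧ ∃ I ∈ A u v, m = {(u, I), (v, e u v I)} := by
  simp only [pairing, Finset.mem_biUnion, Finset.mem_filter, Finset.mem_univ, true_and,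
    Finset.mem_image, Prod.exists, eq_comm]

lemma exists_matching (R : Fin K → Fin K → Prop) (A : Fin K → Fin K → Finset (Pair K))
    (h : ∀ u v, R u v → (A u v).card = (A v u).card) :
    ∃ e : Fin K → Fin K → Pair K → Pair K,
      ∀ u v, R u v → Set.BijOn (e u v) (A u v : Set (Pair K)) (A v u : Set (Pair K)) := by
  have hex : ∀ u v, ∃ f : Pair K → Pair K,
      R u v → Set.BijOn f (A u v : Set (Pair K)) (A v u : Set (Pair K)) := by
    intro u v
    by_cases hR : R u v
    · rcases isEmpty_or_nonempty (Pair K) with hE | hE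
      · exact ⟨id, fun _ => by rw [Set.eq_empty_of_isEmpty (A u v : Set (Pair K)),
          Set.eq_empty_of_isEmpty (A v u : Set (Pair K))]; exact Set.bijOn_empty _⟩
      · obtain ⟨f, hf⟩ := (A u v).finite_toSet.exists_bijOn_of_encard_eq
          (t := (A v u : Set (Pair K))) (by simp [Set.encard_coe_eq_coe_finsetCard, h u v hR])
        exact ⟨f, fun _ => hf⟩
    · exact ⟨id, fun h => absurd h hR⟩
  choose e he using hex
  exact ⟨e, he⟩

section pairing

variable {R : Fin K → Fin K → Prop} [DecidableRel R] {A : Fin K → Fin K → Finset (Pair K)}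
  {e : Fin K → Fin K → Pair K → Pair K}

lemma mem_of_mem_pairing
    (he : ∀ u v, R u v → Set.BijOn (e u v) (A u v : Set (Pair K)) (A v u : Set (Pair K)))
    (x : Fin K × Pair K) :
    (∃ m ∈ pairing R A e, x ∈ m) ↔ ∃ v, (R x.1 v ∨ R v x.1) ∧ x.2 ∈ A x.1 v := by
  constructor
  · rintro ⟨m, hm, hx⟩
    obtain ⟨u, v, hR, I, hI, rfl⟩ := mem_pairing.1 hm
    rw [Finset.mem_insert, Finset.mem_singleton] at hx
    rcases hx with rfl | rfl
    · exact ⟨v, Or.inl hR, hI⟩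
    · exact ⟨u, Or.inr hR, (he u v hR).mapsTo hI⟩
  · obtain ⟨u, I⟩ := x
    rintro ⟨v, hR | hR, hI⟩
    · exact ⟨_, mem_pairing.2 ⟨u, v, hR, I, hI, rfl⟩, by simp⟩
    · obtain ⟨I', hI', rfl⟩ := (he v u hR).surjOn hI
      exact ⟨_, mem_pairing.2 ⟨v, u, hR, I', hI', rfl⟩, by simp⟩

/-- A sub-file needed by `u` determines the partner `v` by `hA`, asymmetry fixes which of the two is
listed first, and injectivity of the matching fixes the rest of the message. -/
lemma pairing_disjoint (hasymm : ∀ u v, R u v → ¬R v u)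
    (he : ∀ u v, R u v → Set.BijOn (e u v) (A u v : Set (Pair K)) (A v u : Set (Pair K)))
    (hA : ∀ u v v' I, (R u v ∨ R v u) → (R u v' ∨ R v' u) → I ∈ A u v → I ∈ A u v' → v = v') :
    ∀ m ∈ pairing R A e, ∀ m' ∈ pairing R A e, m ≠ m' → Disjoint m m' := by
  intro m hm m' hm' hne
  obtain ⟨u, v, hR, I, hI, rfl⟩ := mem_pairing.1 hm
  obtain ⟨u', v', hR', I', hI', rfl⟩ := mem_pairing.1 hm'
  have hJ := (he u v hR).mapsTo hI
  have hJ' := (he u' v' hR').mapsTo hI'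
  rw [Finset.disjoint_left]
  intro x hx hx'
  apply hne
  simp only [Finset.mem_insert, Finset.mem_singleton] at hx hx'
  rcases hx with rfl | rfl <;> rcases hx' with h | h <;> simp only [Prod.mk.injEq] at h <;>
    obtain ⟨rfl, h⟩ := h
  · subst h
    obtain rfl := hA u v v' I (Or.inl hR) (Or.inl hR') hI hI'
    rfl
  · rw [← h] at hJ'
    obtain rfl := hA u v u' I (Or.inl hR) (Or.inr hR') hI hJ'
    exact absurd hR (hasymm _ _ hR')
  · rw [h] at hJ
    obtain rfl := hA v u v' I' (Or.inr hR) (Or.inl hR') hJ hI'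
    exact absurd hR (hasymm _ _ hR')
  · have hJ2 := hJ
    rw [h] at hJ2
    obtain rfl := hA v u u' _ (Or.inr hR) (Or.inr hR') hJ2 hJ'
    rw [(he u v hR).injOn hI hI' h]

lemma card_of_mem_pairing (hirr : ∀ u v, R u v → u ≠ v) {m : Message K}
    (hm : m ∈ pairing R A e) : m.card = 2 := by
  obtain ⟨u, v, hR, I, hI, rfl⟩ := mem_pairing.1 hm
  exact Finset.card_pair fun h => hirr u v hR (congrArg Prod.fst h)

lemma two_mul_card_pairing (hasymm : ∀ u v, R u v → ¬R v u)
    (he : ∀ u v, R u v → Set.BijOn (e u v) (A u v : Set (Pair K)) (A v u : Set (Pair K)))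
    (hA : ∀ u v v' I, (R u v ∨ R v u) → (R u v' ∨ R v' u) → I ∈ A u v → I ∈ A u v' → v = v') :
    2 * (pairing R A e).card = ((pairing R A e).biUnion id).card := by
  have hirr : ∀ u v, R u v → u ≠ v := by
    rintro u v h rfl
    exact hasymm u u h h
  rw [Finset.card_biUnion (t := id) fun m hm m' hm' hne => pairing_disjoint hasymm he hA m hm m' hm' hne,
    Finset.sum_congr rfl fun m hm => card_of_mem_pairing (m := id m) hirr hm, Finset.sum_const,
    smul_eq_mul, mul_comm]

/-- This is the side condition of `decodable_of_forall_missing`: each recipient caches the sub-file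
meant for the other. -/
lemma mem_cache_of_mem_pairing {P : Placement K N} {d : Fin K → Fin N}
    (he : ∀ u v, R u v → Set.BijOn (e u v) (A u v : Set (Pair K)) (A v u : Set (Pair K)))
    (hav : ∀ u v, (R u v ∨ R v u) → A u v ⊆ avail P d u v) {m : Message K}
    (hm : m ∈ pairing R A e) : ∀ x ∈ m, ∀ y ∈ m, x ≠ y → x.1 ∈ P (d y.1) y.2 := by
  obtain ⟨u, v, hR, I, hI, rfl⟩ := mem_pairing.1 hm
  have h1 := (Finset.mem_filter.1 (hav u v (Or.inl hR) hI)).2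
  have h2 := (Finset.mem_filter.1 (hav v u (Or.inr hR) ((he u v hR).mapsTo hI))).2
  intro x hx y hy hxy
  simp only [Finset.mem_insert, Finset.mem_singleton] at hx hy
  rcases hx with rfl | rfl <;> rcases hy with rfl | rfl
  · exact absurd rfl hxy
  · exact h2
  · exact h1
  · exact absurd rfl hxy

end pairing

/-! ### Delivery with at most one high-level user. -/

lemma mem_avail {P : Placement K N} {d : Fin K → Fin N} {r c : Fin K} {I : Pair K} :
    I ∈ avail P d r c ↔ r ∉ P (d r) I ∧ c ∈ P (d r) I := by
  simp [avail, missing]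

lemma EvenlySplit.eq_of_mem {P : Placement K N} {n : Fin N} (h : EvenlySplit P n) {I : Pair K}
    {u v : Fin K} (hu : u ∈ P n I) (hv : v ∈ P n I) : u = v :=
  Finset.card_le_one.1 (h.1 I).le u hu v hv

lemma EvenlySplit.exists_mem {P : Placement K N} {n : Fin N} (h : EvenlySplit P n) (I : Pair K) :
    ∃ u, u ∈ P n I :=
  Finset.card_pos.1 (by rw [h.1 I]; norm_num)

lemma EvenlySplit.card_avail {P : Placement K N} {d : Fin K → Fin N} {r c : Fin K} {q : ℕ}
    (hc : K.choose 2 = K * q) (h : EvenlySplit P (d r)) (hrc : r ≠ c) :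
    (avail P d r c).card = q := by
  rw [← h.card_eq hc c]
  congr 1
  ext I
  simp only [mem_avail, Finset.mem_filter, Finset.mem_univ, true_and, and_iff_right_iff_imp]
  exact fun hI hr => hrc (h.eq_of_mem hr hI)

/-- Delivery with at most one high-level user. -/
lemma exists_fallbackDelivery {F b Nh q : ℕ} (hq : K = 2 * q + 1) (hc : K.choose 2 = K * q)
    (split : Fin F ≃ Pair K × Fin b) {P : Placement K N} (hP : IsCL21Placement Nh P)
    (d : Fin K → Fin N) :
    ∃ D, IsFallbackDelivery P d D ∧ Decodable split P d D ∧ D.card = K.choose 2 * q := by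
  obtain ⟨w, hwm, hw⟩ := exists_even_owner hq
  -- Of the two copies of a high-level sub-file, only that of the owner of its index is kept. All
  -- files are then evenly split.
  let P' : Placement K N := fun n I => if n.val < Nh then {w I} else P n I
  have hsub : ∀ n I, P' n I ⊆ P n I := by
    intro n I
    simp only [P']
    split_ifs with h
    · rw [hP.1 n h]
      simpa using hwm I
    · exact subset_rfl
  have hev : ∀ n, EvenlySplit P' n := by
    intro n
    by_cases h : n.val < Nh
    · exact evenlySplit_owner hc (fun I => by simp [P', h]) hw
    · have h1 := hP.2 n (by omega)
      simpa only [EvenlySplit, P', if_neg h] using h1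
  obtain ⟨e, he⟩ := exists_matching (fun u v : Fin K => u < v) (avail P' d) fun u v huv => by
    rw [(hev _).card_avail hc huv.ne, (hev _).card_avail hc huv.ne']
  have hdisj : ∀ u v v' I, (u < v ∨ v < u) → (u < v' ∨ v' < u) → I ∈ avail P' d u v →
      I ∈ avail P' d u v' → v = v' := by
    intro u v v' I _ _ h1 h2
    exact (hev _).eq_of_mem (mem_avail.1 h1).2 (mem_avail.1 h2).2
  have hcover : ∀ x : Fin K × Pair K, (∃ m ∈ pairing (fun u v => u < v) (avail P' d) e, x ∈ m) ↔
      x.1 ∉ P' (d x.1) x.2 := by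
    intro x
    rw [mem_of_mem_pairing he]
    constructor
    · rintro ⟨v, -, h⟩
      exact (mem_avail.1 h).1
    · intro h
      obtain ⟨v, hv⟩ := (hev (d x.1)).exists_mem x.2
      have hne : x.1 ≠ v := by rintro h'; exact h (h' ▸ hv)
      exact ⟨v, lt_or_gt_of_ne hne, mem_avail.2 ⟨h, hv⟩⟩
  refine ⟨pairing (fun u v => u < v) (avail P' d) e, ⟨P', hsub, fun u => hev _, e,
    fun j _ k _ h => he j k h, fun m => ?_⟩, ?_, ?_⟩
  · simp [mem_pairing]
  · refine decodable_of_forall_missing split P d _ fun u I hI => ?_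
    obtain ⟨m, hm, hx⟩ := (hcover (u, I)).2 fun h => hI (hsub _ _ h)
    refine ⟨m, hm, hx, fun x hxm hne => hsub _ _ ?_⟩
    exact mem_cache_of_mem_pairing he (fun _ _ _ => subset_rfl) hm (u, I) hx x hxm hne.symm
  -- Each of the `K` users misses `K * q - q = 2 * q * q` sub-files under `P'`, and each message
  -- serves two.
  · have h1 := two_mul_card_pairing (fun u v h h' => lt_asymm h h') he hdisj
    have h2 : (pairing (fun u v => u < v) (avail P' d) e).biUnion id =
        Finset.univ.filter fun x : Fin K × Pair K => x.1 ∉ P' (d x.1) x.2 := by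
      ext x
      simpa using hcover x
    have h3 : (Finset.univ.filter fun x : Fin K × Pair K => x.1 ∉ P' (d x.1) x.2).card =
        K * (K * q - q) := by
      rw [Finset.card_filter, Fintype.sum_prod_type]
      simp only [← Finset.card_filter]
      have : ∀ u : Fin K, (Finset.univ.filter fun I : Pair K => u ∉ P' (d u) I).card =
          K * q - q := by
        intro u
        have h := Finset.card_filter_add_card_filter_not (s := (Finset.univ : Finset (Pair K)))
          (fun I => u ∈ P' (d u) I)
        rw [card_pair_univ, hc, (hev _).card_eq hc] at h
        omega
      simp [this]
    rw [h2, h3] at h1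
    rw [hc]
    have h4 : K * q - q = 2 * q * q := by
      rw [hq, Nat.add_mul, one_mul, Nat.add_sub_cancel]
    rw [h4] at h1
    have h5 : K * (2 * q * q) = 2 * (K * q * q) := by ring
    omega

/-! ### Messages for triples of high-level users. -/

lemma mem_tripleMessages {A : Finset (Fin K)} {m : Message K} :
    m ∈ tripleMessages A ↔ ∃ S ⊆ A, S.card = 3 ∧
      m = Finset.univ.filter fun x : Fin K × Pair K => x.1 ∈ S ∧ x.2.1 = S.erase x.1 := by
  simp only [tripleMessages, Finset.mem_image, Finset.mem_powersetCard, and_assoc, eq_comm]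

/-- The set `S` can be read off its message as the set of first components. -/
lemma card_tripleMessages (A : Finset (Fin K)) :
    (tripleMessages A).card = A.card.choose 3 := by
  have key : ∀ S S' : Finset (Fin K), S.card = 3 →
      (Finset.univ.filter fun x : Fin K × Pair K => x.1 ∈ S ∧ x.2.1 = S.erase x.1) =
        (Finset.univ.filter fun x : Fin K × Pair K => x.1 ∈ S' ∧ x.2.1 = S'.erase x.1) →
      S ⊆ S' := by
    intro S S' hS h s hs
    have h1 : (s, (⟨S.erase s, by rw [Finset.card_erase_of_mem hs, hS]⟩ : Pair K)) ∈
        Finset.univ.filter fun x : Fin K × Pair K => x.1 ∈ S ∧ x.2.1 = S.erase x.1 := by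
      simpa using hs
    rw [h] at h1
    exact (Finset.mem_filter.1 h1).2.1
  rw [tripleMessages, Finset.card_image_of_injOn, Finset.card_powersetCard]
  intro S hS S' hS' h
  exact Finset.Subset.antisymm (key S S' (Finset.mem_powersetCard.1 hS).2 h)
    (key S' S (Finset.mem_powersetCard.1 hS').2 h.symm)

/-- These are the demands served by the triple messages. Each `u ∈ H` has `C(h - 1, 2)` of them, and
`h * C(h - 1, 2) = 3 * C(h, 3)`. -/
lemma card_filter_subset_of_notMem (H : Finset (Fin K)) :
    (Finset.univ.filter fun x : Fin K × Pair K => x.1 ∉ x.2.1 ∧ x.1 ∈ H ∧ x.2.1 ⊆ H).card =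
      3 * H.card.choose 3 := by
  rw [Finset.card_filter, Fintype.sum_prod_type]
  simp only [← Finset.card_filter]
  have h : ∀ u : Fin K,
      (Finset.univ.filter fun I : Pair K => u ∉ I.1 ∧ u ∈ H ∧ I.1 ⊆ H).card =
        if u ∈ H then (H.card - 1).choose 2 else 0 := by
    intro u
    split_ifs with hu
    · rw [← Finset.card_erase_of_mem hu, ← card_filter_pair_subset]
      congr 1
      ext I
      simp only [Finset.mem_filter, Finset.mem_univ, true_and, hu, Finset.subset_erase]
      tauto
    · simp [hu]
  rw [Finset.sum_congr rfl fun u _ => h u, ← Finset.sum_filter, Finset.sum_const]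
  simp only [Finset.filter_univ_mem, smul_eq_mul]
  rcases Nat.eq_zero_or_pos H.card with h0 | h0
  · simp [h0]
  · have := Nat.add_one_mul_choose_eq (H.card - 1) 2
    rw [show H.card - 1 + 1 = H.card by omega] at this
    rw [this, mul_comm]

/-! ### Distributing the sub-files needed by a high-level user among the suppliers. -/

lemma Pair.eq_or_eq_or_eq (I : Pair K) {a b c : Fin K} (ha : a ∈ I.1) (hb : b ∈ I.1)
    (hc : c ∈ I.1) : a = b ∨ a = c ∨ b = c := by
  by_contra h
  push Not at h
  rw [I.eq_of_mem ha hb h.1] at hc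
  simp only [Finset.mem_insert, Finset.mem_singleton] at hc
  rcases hc with rfl | rfl
  · exact h.2.1 rfl
  · exact h.2.2 rfl

/-- The sub-files that the high-level user `u` receives in coded messages shared with user `v`.
The low-level users form the set `L`, the pairs inside `L` are distributed by `w`, and the pairs
`{j, k}` with `j ∈ L` and `k ∉ L` are received from `k` if `k ∈ U j u`, from `j` if `k ∉ T j u`. -/
def highSet (L : Finset (Fin K)) (w : Pair K → Fin K) (T U : Fin K → Fin K → Finset (Fin K))
    (u v : Fin K) : Finset (Pair K) :=
  if v ∈ L then
    Finset.univ.filter fun I => u ∉ I.1 ∧ v ∈ I.1 ∧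
      ((I.1 ⊆ L ∧ w I = v) ∨ ∃ k ∈ I.1, k ∉ L ∧ k ∉ T v u)
  else Finset.univ.filter fun I => u ∉ I.1 ∧ v ∈ I.1 ∧ ∃ j ∈ I.1, j ∈ L ∧ v ∈ U j u

/-- The sub-files of high-level users that are sent uncoded. -/
def unicastSet (L : Finset (Fin K)) (T U : Fin K → Fin K → Finset (Fin K)) :
    Finset (Fin K × Pair K) :=
  Finset.univ.filter fun x => x.1 ∉ L ∧ x.1 ∉ x.2.1 ∧
    ∃ j ∈ x.2.1, j ∈ L ∧ ∃ k ∈ x.2.1, k ∈ T j x.1 ∧ k ∉ U j x.1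

section highSet

variable {L : Finset (Fin K)} {w : Pair K → Fin K} {T U : Fin K → Fin K → Finset (Fin K)}

lemma mem_highSet_low {u v : Fin K} (hv : v ∈ L) {I : Pair K} :
    I ∈ highSet L w T U u v ↔ u ∉ I.1 ∧ v ∈ I.1 ∧
      ((I.1 ⊆ L ∧ w I = v) ∨ ∃ k ∈ I.1, k ∉ L ∧ k ∉ T v u) := by
  simp [highSet, hv]

lemma mem_highSet_high {u v : Fin K} (hv : v ∉ L) {I : Pair K} :
    I ∈ highSet L w T U u v ↔ u ∉ I.1 ∧ v ∈ I.1 ∧ ∃ j ∈ I.1, j ∈ L ∧ v ∈ U j u := by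
  simp [highSet, hv]

lemma highSet_notMem_mem {u v : Fin K} {I : Pair K} (h : I ∈ highSet L w T U u v) :
    u ∉ I.1 ∧ v ∈ I.1 := by
  by_cases hv : v ∈ L
  · rw [mem_highSet_low hv] at h
    exact ⟨h.1, h.2.1⟩
  · rw [mem_highSet_high hv] at h
    exact ⟨h.1, h.2.1⟩

/-- A mixed pair `{j, k}` comes from `j` when `k ∉ T j u` and from `k` when `k ∈ U j u`; the
inclusion of `U` in `T` makes these exclusive. -/
lemma highSet_disjoint {u : Fin K} (hU : ∀ j ∈ L, U j u ⊆ T j u) {v v' : Fin K} {I : Pair K}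
    (h : I ∈ highSet L w T U u v) (h' : I ∈ highSet L w T U u v') : v = v' := by
  have key : ∀ v v' : Fin K, v ∈ L → v' ∉ L → I ∈ highSet L w T U u v →
      I ∉ highSet L w T U u v' := by
    intro v v' hv hv' h h'
    rw [mem_highSet_low hv] at h
    rw [mem_highSet_high hv'] at h'
    obtain ⟨-, hvI, h⟩ := h
    obtain ⟨-, hvI', j, hj, hjL, hjU⟩ := h'
    have hjv : j = v := by
      have := I.eq_or_eq_or_eq hvI hvI' hj
      grind
    subst hjv
    rcases h with ⟨h, -⟩ | ⟨k, hk, hkL, hkT⟩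
    · exact hv' (h hvI')
    · have : k = v' := by
        have := I.eq_or_eq_or_eq hvI hvI' hk
        grind
      subst this
      exact hkT (hU j hjL hjU)
  by_cases hv : v ∈ L <;> by_cases hv' : v' ∈ L
  · rw [mem_highSet_low hv] at h
    rw [mem_highSet_low hv'] at h'
    obtain ⟨-, hvI, h⟩ := h
    obtain ⟨-, hvI', h'⟩ := h'
    rcases h with ⟨h, h1⟩ | ⟨k, hk, hkL, -⟩
    · rcases h' with ⟨-, h2⟩ | ⟨k, hk, hkL, -⟩
      · rw [← h1, ← h2]
      · exact absurd (h hk) hkL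
    · have := I.eq_or_eq_or_eq hvI hvI' hk
      grind
  · exact absurd h' (key v v' hv hv' h)
  · exact absurd h (key v' v hv' hv h')
  · rw [mem_highSet_high hv] at h
    rw [mem_highSet_high hv'] at h'
    obtain ⟨-, hvI, j, hj, hjL, -⟩ := h
    have := I.eq_or_eq_or_eq hvI h'.2.1 hj
    grind

/-- The remaining alternative for a mixed pair is `k ∈ T j u` with `k ∉ U j u`, so unicast sub-files
have no supplier. -/
lemma notMem_highSet_of_mem_unicastSet {u : Fin K}
    (hT : ∀ j ∈ L, T j u ∩ L = ∅) {I : Pair K} (h : (u, I) ∈ unicastSet L T U) (v : Fin K) :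
    I ∉ highSet L w T U u v := by
  simp only [unicastSet, Finset.mem_filter, Finset.mem_univ, true_and] at h
  obtain ⟨hu, huI, j, hj, hjL, k, hk, hkT, hkU⟩ := h
  have hkL : k ∉ L := fun h => by
    have : k ∈ T j u ∩ L := Finset.mem_inter.2 ⟨hkT, h⟩
    simp [hT j hjL] at this
  intro hI
  by_cases hv : v ∈ L
  · rw [mem_highSet_low hv] at hI
    obtain ⟨-, hvI, h⟩ := hI
    have hvj : v = j := by
      have := I.eq_or_eq_or_eq hvI hk hj
      grind
    subst hvj
    rcases h with ⟨h, -⟩ | ⟨k', hk', hkL', hkT'⟩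
    · exact hkL (h hk)
    · have : k' = k := by
        have := I.eq_or_eq_or_eq hk' hk hj
        grind
      exact hkT' (this ▸ hkT)
  · rw [mem_highSet_high hv] at hI
    obtain ⟨-, hvI, j', hj', hjL', hjU⟩ := hI
    have h1 : v = k := by
      have := I.eq_or_eq_or_eq hvI hk hj
      grind
    have h2 : j' = j := by
      have := I.eq_or_eq_or_eq hj' hk hj
      grind
    subst h1 h2
    exact hkU hjU

lemma exists_mem_highSet_or_mem_unicastSet {u : Fin K} (hu : u ∉ L)
    (hw : ∀ I : Pair K, I.1 ⊆ L → w I ∈ I.1) {I : Pair K} (huI : u ∉ I.1)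
    (hI : ∃ j ∈ I.1, j ∈ L) :
    (∃ v, I ∈ highSet L w T U u v) ∨ (u, I) ∈ unicastSet L T U := by
  by_cases hIL : I.1 ⊆ L
  · exact Or.inl ⟨w I, (mem_highSet_low (hIL (hw I hIL))).2 ⟨huI, hw I hIL, Or.inl ⟨hIL, rfl⟩⟩⟩
  · obtain ⟨k, hk, hkL⟩ := Finset.not_subset.1 hIL
    obtain ⟨j, hj, hjL⟩ := hI
    by_cases hkT : k ∈ T j u
    · by_cases hkU : k ∈ U j u
      · exact Or.inl ⟨k, (mem_highSet_high hkL).2 ⟨huI, hk, j, hj, hjL, hkU⟩⟩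
      · refine Or.inr ?_
        simp only [unicastSet, Finset.mem_filter, Finset.mem_univ, true_and]
        exact ⟨hu, huI, j, hj, hjL, k, hk, hkT, hkU⟩
    · exact Or.inl ⟨j, (mem_highSet_low hjL).2 ⟨huI, hj, Or.inr ⟨k, hk, hkL, hkT⟩⟩⟩

lemma card_highSet_high {u v : Fin K} (hu : u ∉ L) (hv : v ∉ L) (huv : u ≠ v) :
    (highSet L w T U u v).card = (L.filter fun j => v ∈ U j u).card := by
  rw [← card_filter_pair (u := v) (B := L.filter fun j => v ∈ U j u) (by simp [hv])]
  congr 1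
  ext I
  simp only [mem_highSet_high hv, Finset.mem_filter, Finset.mem_univ, true_and]
  constructor
  · rintro ⟨-, hvI, j, hj, hjL, hjU⟩
    exact ⟨j, ⟨hjL, hjU⟩, I.eq_of_mem hvI hj fun h => hv (h ▸ hjL)⟩
  · rintro ⟨j, ⟨hjL, hjU⟩, h⟩
    simp only [h, Finset.mem_insert, Finset.mem_singleton, true_or, true_and, not_or]
    exact ⟨⟨huv, fun h => hu (h ▸ hjL)⟩, j, Or.inr rfl, hjL, hjU⟩

/-- User `v` supplies the pairs it owns inside `L` and the pairs `{v, k}` with `k` high-level, `k ≠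
u` and `k ∉ T v u`. The summand `1` accounts for the exclusion of `u`. -/
lemma card_highSet_low {u v : Fin K} (hu : u ∉ L) (hv : v ∈ L)
    (hw : ∀ I : Pair K, I.1 ⊆ L → w I ∈ I.1) (hT : T v u ⊆ Lᶜ.erase u) :
    (highSet L w T U u v).card + (T v u).card + 1 =
      (Finset.univ.filter fun I : Pair K => I.1 ⊆ L ∧ w I = v).card + Lᶜ.card := by
  have h : highSet L w T U u v = (Finset.univ.filter fun I : Pair K => I.1 ⊆ L ∧ w I = v) ∪
      Finset.univ.filter fun I : Pair K => ∃ k ∈ Lᶜ.erase u \ T v u, I.1 = {v, k} := by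
    ext I
    simp only [mem_highSet_low hv, Finset.mem_union, Finset.mem_filter, Finset.mem_univ, true_and,
      Finset.mem_sdiff, Finset.mem_erase, Finset.mem_compl]
    constructor
    · rintro ⟨huI, hvI, h | ⟨k, hk, hkL, hkT⟩⟩
      · exact Or.inl h
      · exact Or.inr ⟨k, ⟨⟨fun h => huI (h ▸ hk), hkL⟩, hkT⟩,
          I.eq_of_mem hvI hk fun h => hkL (h ▸ hv)⟩
    · rintro (⟨h, rfl⟩ | ⟨k, ⟨⟨hku, hkL⟩, hkT⟩, h⟩)
      · exact ⟨fun h' => hu (h h'), hw I h, Or.inl ⟨h, rfl⟩⟩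
      · simp only [h, Finset.mem_insert, Finset.mem_singleton, true_or, true_and, not_or]
        exact ⟨⟨fun h => hu (h ▸ hv), hku.symm⟩, Or.inr ⟨k, Or.inr rfl, hkL, hkT⟩⟩
  rw [h, Finset.card_union_of_disjoint, card_filter_pair (by simp [hv]),
    Finset.card_sdiff_of_subset hT, Finset.card_erase_of_mem (by simpa using hu)]
  · have h1 := Finset.card_le_card hT
    rw [Finset.card_erase_of_mem (by simpa using hu)] at h1
    have h2 : 0 < Lᶜ.card := Finset.card_pos.2 ⟨u, by simpa using hu⟩
    omega
  · rw [Finset.disjoint_left]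
    intro I h1 h2
    obtain ⟨h1, -⟩ := (Finset.mem_filter.1 h1).2
    obtain ⟨k, hk, h2⟩ := (Finset.mem_filter.1 h2).2
    simp only [Finset.mem_sdiff, Finset.mem_erase, Finset.mem_compl] at hk
    exact hk.1.2 (h1 (by simp [h2]))

end highSet

/-! ### Delivery with at least two high-level users. -/

lemma mem_highUsers_iff {Nh : ℕ} {d : Fin K → Fin N} {u : Fin K} :
    u ∈ highUsers Nh d ↔ u ∉ lowUsers Nh d := by
  simp [highUsers, lowUsers]

lemma highUsers_eq_compl (Nh : ℕ) (d : Fin K → Fin N) : highUsers Nh d = (lowUsers Nh d)ᶜ := by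
  ext u
  rw [mem_highUsers_iff, Finset.mem_compl]

lemma IsCL21Placement.eq_of_notMem_lowUsers {P : Placement K N} {Nh : ℕ}
    (hP : IsCL21Placement Nh P) {d : Fin K → Fin N} {u : Fin K} (hu : u ∉ lowUsers Nh d)
    (I : Pair K) : P (d u) I = I.1 :=
  hP.1 _ (by simpa [lowUsers] using hu) I

lemma IsCL21Placement.evenlySplit_of_mem_lowUsers {P : Placement K N} {Nh : ℕ}
    (hP : IsCL21Placement Nh P) {d : Fin K → Fin N} {u : Fin K} (hu : u ∈ lowUsers Nh d) :
    EvenlySplit P (d u) :=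
  hP.2 _ (by simpa [lowUsers] using hu)

/-- Delivery with at least two high-level users: besides the messages for triples of high-level
users there are `p` messages that are useful for two users and `ε ≤ 1` unicast messages. -/
lemma exists_fourStepDelivery {F b Nh q : ℕ} (hq : K = 2 * q + 1) (hc : K.choose 2 = K * q)
    (split : Fin F ≃ Pair K × Fin b) {P : Placement K N} (hP : IsCL21Placement Nh P)
    (d : Fin K → Fin N) (hkh : 2 ≤ (highUsers Nh d).card) :
    ∃ D, IsFourStepDelivery Nh P d D ∧ Decodable split P d D ∧ ∃ p ε, ε ≤ 1 ∧
      D.card = (highUsers Nh d).card.choose 3 + (p + ε) ∧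
      2 * p + ε + 3 * (highUsers Nh d).card.choose 3 = ∑ u, (missing P d u).card := by
  classical
  have hHL : ∀ u, u ∈ highUsers Nh d ↔ u ∉ lowUsers Nh d := fun u => mem_highUsers_iff
  have hHc := highUsers_eq_compl Nh d
  have hKc := card_highUsers_add_card_lowUsers Nh d
  have hPH : ∀ u, u ∉ lowUsers Nh d → ∀ I, P (d u) I = I.1 :=
    fun u hu => hP.eq_of_notMem_lowUsers hu
  have hPL : ∀ u ∈ lowUsers Nh d, EvenlySplit P (d u) :=
    fun u hu => hP.evenlySplit_of_mem_lowUsers hu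
  have hOmega : ∀ u ∉ lowUsers Nh d, ∀ v I, I ∈ Omega Nh P d u v ↔
      u ∉ I.1 ∧ v ∈ I.1 ∧ ∃ k ∈ I.1, k ∉ lowUsers Nh d := by
    intro u hu v I
    simp only [Omega, Finset.mem_filter, mem_avail, hPH u hu, hHL, and_assoc]
    simp only [and_comm]
  have hLam : ∀ u ∉ lowUsers Nh d, ∀ I, I ∈ Lam Nh P d u ↔ I.1 ⊆ lowUsers Nh d := by
    intro u hu I
    simp only [Lam, missing, Finset.mem_filter, Finset.mem_univ, true_and, hPH u hu,
      and_iff_right_iff_imp]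
    exact fun h h' => hu (h h')
  have havail : ∀ u ∉ lowUsers Nh d, ∀ v I, I ∈ avail P d u v ↔ u ∉ I.1 ∧ v ∈ I.1 := by
    intro u hu v I
    rw [mem_avail, hPH u hu]
  generalize hLdef : lowUsers Nh d = L at *
  generalize hHdef : highUsers Nh d = H at *
  obtain ⟨w, hw, hwc⟩ := exists_balanced_owner L
  -- The degree is what leaves exactly `q` sub-files for the exchange with `j`. As `h + l = 2q + 1`,
  -- it equals `h / 2 - 1` for even `h`, and `(h - 1) / 2` or one less for odd `h`. Since `h ≥ 2`,
  -- the subtraction is never truncated.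
  obtain ⟨T, U, hTU, hbal, hexc⟩ := exists_arcs L H
    (fun j => H.card - 1 + (Finset.univ.filter fun I : Pair K => I.1 ⊆ L ∧ w I = j).card - q)
    (Finset.card_pos.1 (by omega)) (by
      rcases Nat.even_or_odd' H.card with ⟨r, hr | hr⟩
      · refine Or.inr ⟨⟨r, by omega⟩, fun j hj => ?_⟩
        have := hwc j hj
        omega
      · refine Or.inl ⟨⟨r, by omega⟩, fun j hj => ?_⟩
        have := hwc j hj
        omega)
  have hUT : ∀ u ∉ L, ∀ j ∈ L, U j u ⊆ T j u := fun u hu j hj => (hTU j hj u ((hHL u).2 hu)).2.2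
  have hTL : ∀ u ∉ L, ∀ j ∈ L, ∀ k ∈ T j u, k ∉ L ∧ k ≠ u := by
    intro u hu j hj k hk
    have := Finset.mem_erase.1 ((hTU j hj u ((hHL u).2 hu)).1 hk)
    exact ⟨(hHL k).1 this.2, this.1⟩
  have hTL' : ∀ u ∉ L, ∀ j ∈ L, T j u ∩ L = ∅ := by
    intro u hu j hj
    ext k
    simp only [Finset.mem_inter, Finset.notMem_empty, iff_false, not_and]
    exact fun hk => (hTL u hu j hj k hk).1
  have hcross : ∀ u ∉ L, ∀ v ∈ L, (highSet L w T U u v).card = q := by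
    intro u hu v hv
    obtain ⟨h1, h2, -⟩ := hTU v hv u ((hHL u).2 hu)
    have h3 := card_highSet_low (U := U) hu hv hw (hHc ▸ h1)
    rw [h2, ← hHc] at h3
    have h4 := hwc v hv
    have h5 : 0 < L.card := Finset.card_pos.2 ⟨v, hv⟩
    omega
  have huni : (unicastSet L T U).card ≤ 1 := by
    rw [Finset.card_le_one]
    rintro ⟨u, I⟩ h ⟨u', I'⟩ h'
    simp only [unicastSet, Finset.mem_filter, Finset.mem_univ, true_and] at h h'
    obtain ⟨hu, huI, j, hj, hjL, k, hk, hkT, hkU⟩ := h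
    obtain ⟨hu', huI', j', hj', hjL', k', hk', hkT', hkU'⟩ := h'
    obtain ⟨rfl, rfl, rfl⟩ := hexc j hjL j' hjL' u ((hHL u).2 hu) u' ((hHL u').2 hu') k k'
      hkT hkU hkT' hkU'
    have hjk : j ≠ k := fun h => (hTL u hu j hjL k hkT).1 (h ▸ hjL)
    rw [Prod.mk.injEq]
    exact ⟨rfl, Subtype.ext ((I.eq_of_mem hj hk hjk).trans (I'.eq_of_mem hj' hk' hjk).symm)⟩
  obtain ⟨A, hAL, hAH⟩ : ∃ A : Fin K → Fin K → Finset (Pair K),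
      (∀ u ∈ L, ∀ v, A u v = avail P d u v) ∧ ∀ u ∉ L, ∀ v, A u v = highSet L w T U u v :=
    ⟨fun u v => if u ∈ L then avail P d u v else highSet L w T U u v,
      fun u hu v => by simp [hu], fun u hu v => by simp [hu]⟩
  -- The relations `R₂`, `R₃`, `R₄` select the pairs of users served in steps (2), (3), (4). Their
  -- union `R` orients each pair of distinct users exactly once, so one matching `e` and one
  -- disjointness argument cover all three steps.
  obtain ⟨R₂, hR₂⟩ : ∃ R : Fin K → Fin K → Prop, ∀ u v, R u v ↔ u ∈ L ∧ v ∈ L ∧ u < v :=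
    ⟨_, fun _ _ => Iff.rfl⟩
  obtain ⟨R₃, hR₃⟩ : ∃ R : Fin K → Fin K → Prop, ∀ u v, R u v ↔ u ∉ L ∧ v ∈ L :=
    ⟨_, fun _ _ => Iff.rfl⟩
  obtain ⟨R₄, hR₄⟩ : ∃ R : Fin K → Fin K → Prop, ∀ u v, R u v ↔ u ∉ L ∧ v ∉ L ∧ u < v :=
    ⟨_, fun _ _ => Iff.rfl⟩
  obtain ⟨R, hR⟩ : ∃ R : Fin K → Fin K → Prop, ∀ u v, R u v ↔ R₂ u v ∨ R₃ u v ∨ R₄ u v :=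
    ⟨_, fun _ _ => Iff.rfl⟩
  have hasymm : ∀ u v, R u v → ¬R v u := by
    intro u v
    rw [hR, hR, hR₂, hR₃, hR₄, hR₂, hR₃, hR₄]
    rintro (⟨h1, h2, h3⟩ | ⟨h1, h2⟩ | ⟨h1, h2, h3⟩) (⟨g1, g2, g3⟩ | ⟨g1, g2⟩ | ⟨g1, g2, g3⟩)
    all_goals first
      | exact lt_asymm h3 g3
      | contradiction
  have htot : ∀ u v, u ≠ v → R u v ∨ R v u := by
    intro u v h
    rw [hR, hR, hR₂, hR₃, hR₄, hR₂, hR₃, hR₄]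
    by_cases hu : u ∈ L <;> by_cases hv : v ∈ L <;> rcases lt_or_gt_of_ne h with h | h <;>
      simp [hu, hv, h]
  have hirr : ∀ u v, R u v → u ≠ v := by
    rintro u v h rfl
    exact hasymm u u h h
  obtain ⟨e, he⟩ := exists_matching R A fun u v huv => by
    have hne := hirr u v huv
    rw [hR, hR₂, hR₃, hR₄] at huv
    rcases huv with ⟨hu, hv, -⟩ | ⟨hu, hv⟩ | ⟨hu, hv, -⟩
    · rw [hAL u hu, hAL v hv, (hPL u hu).card_avail hc hne, (hPL v hv).card_avail hc hne.symm]
    · rw [hAH u hu, hAL v hv, hcross u hu v hv, (hPL v hv).card_avail hc hne.symm]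
    · rw [hAH u hu, hAH v hv, card_highSet_high hu hv hne, card_highSet_high hv hu hne.symm]
      exact hbal u ((hHL u).2 hu) v ((hHL v).2 hv)
  have hsub : ∀ u v, A u v ⊆ avail P d u v := by
    intro u v I hI
    by_cases hu : u ∈ L
    · rwa [hAL u hu] at hI
    · rw [hAH u hu] at hI
      rw [havail u hu]
      exact highSet_notMem_mem hI
  have hdisj : ∀ u v v' I, I ∈ A u v → I ∈ A u v' → v = v' := by
    intro u v v' I h h'
    by_cases hu : u ∈ L
    · rw [hAL u hu, mem_avail] at h h'
      exact (hPL u hu).eq_of_mem h.2 h'.2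
    · rw [hAH u hu] at h h'
      exact highSet_disjoint (hUT u hu) h h'
  have hcover : ∀ x : Fin K × Pair K, (∃ m ∈ pairing R A e, x ∈ m) ↔
      ∃ v, x.2 ∈ A x.1 v := by
    intro x
    rw [mem_of_mem_pairing he]
    refine ⟨fun ⟨v, _, h⟩ => ⟨v, h⟩, fun ⟨v, h⟩ => ⟨v, htot _ _ ?_, h⟩⟩
    have h1 := mem_avail.1 (hsub _ _ h)
    exact fun h2 => h1.1 (by rw [← h2] at h1; exact h1.2)
  have huniA : ∀ x ∈ unicastSet L T U, ∀ v, x.2 ∉ A x.1 v := by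
    intro x hx v
    have hu : x.1 ∉ L := (Finset.mem_filter.1 hx).2.1
    rw [hAH _ hu]
    exact notMem_highSet_of_mem_unicastSet (hTL' _ hu) hx v
  -- Every missing sub-file is served by a triple message, a paired message or a unicast. Together
  -- with `hexcl` and `huniA` this is a partition, which yields both decodability and the count.
  have hmissing : ∀ x : Fin K × Pair K, x.1 ∉ P (d x.1) x.2 ↔
      (x.1 ∉ x.2.1 ∧ x.1 ∈ H ∧ x.2.1 ⊆ H) ∨ (∃ v, x.2 ∈ A x.1 v) ∨ x ∈ unicastSet L T U := by
    rintro ⟨u, I⟩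
    constructor
    · intro h
      by_cases hu : u ∈ L
      · obtain ⟨v, hv⟩ := (hPL u hu).exists_mem I
        refine Or.inr (Or.inl ⟨v, ?_⟩)
        rw [hAL u hu, mem_avail]
        exact ⟨h, hv⟩
      · simp only [hPH u hu] at h
        by_cases hI : I.1 ⊆ H
        · exact Or.inl ⟨h, (hHL u).2 hu, hI⟩
        · obtain ⟨j, hj, hjH⟩ := Finset.not_subset.1 hI
          rw [hHL, not_not] at hjH
          refine Or.inr ?_
          simp only [hAH u hu]
          exact exists_mem_highSet_or_mem_unicastSet hu hw h ⟨j, hj, hjH⟩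
    · rintro (⟨h1, h2, -⟩ | ⟨v, h⟩ | h)
      · rwa [hPH u ((hHL u).1 h2)]
      · exact (mem_avail.1 (hsub _ _ h)).1
      · have h1 := (Finset.mem_filter.1 h).2
        rw [hPH u h1.1]
        exact h1.2.1
  have hexcl : ∀ x : Fin K × Pair K, (x.1 ∉ x.2.1 ∧ x.1 ∈ H ∧ x.2.1 ⊆ H) →
      (∀ v, x.2 ∉ A x.1 v) ∧ x ∉ unicastSet L T U := by
    rintro ⟨u, I⟩ ⟨-, hu, hI⟩
    have hI' : ∀ j ∈ I.1, j ∉ L := fun j hj => (hHL j).1 (hI hj)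
    refine ⟨fun v hv => ?_, fun h => ?_⟩
    · simp only [hAH u ((hHL u).1 hu)] at hv
      have hvL := hI' v (highSet_notMem_mem hv).2
      rw [mem_highSet_high hvL] at hv
      obtain ⟨-, -, j, hj, hjL, -⟩ := hv
      exact hI' j hj hjL
    · obtain ⟨-, -, j, hj, hjL, -⟩ := (Finset.mem_filter.1 h).2
      exact hI' j hj hjL
  have he₄ : ∀ u v, R₄ u v → Set.BijOn (e u v) (A u v : Set (Pair K)) (A v u : Set (Pair K)) :=
    fun u v h => he u v ((hR u v).2 (Or.inr (Or.inr h)))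
  have hpair : pairing R A e = pairing R₂ A e ∪ pairing R₃ A e ∪ pairing R₄ A e := by
    ext m
    simp only [Finset.mem_union, mem_pairing, hR, or_and_right, exists_or, or_assoc]
  have hpairuni : ∀ m ∈ pairing R A e, ∀ x ∈ m, x ∉ unicastSet L T U := by
    intro m hm x hx h
    obtain ⟨v, hv⟩ := (hcover x).1 ⟨m, hm, hx⟩
    exact huniA x h v hv
  -- All arcs of `T` are set aside, including the exceptional one outside `U`, which is delivered as
  -- the unicast.
  let Δ : Fin K → Fin K → Finset (Pair K) := fun i j =>
    Finset.univ.filter fun I => j ∈ I.1 ∧ ∃ k ∈ I.1, k ∈ T j i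
  have hΔ : ∀ i j I, I ∈ Δ i j ↔ j ∈ I.1 ∧ ∃ k ∈ I.1, k ∈ T j i := by
    intro i j I; simp [Δ]
  have hΔu : ∀ u ∉ L, ∀ j ∈ L, ∀ I ∈ Δ u j, u ∉ I.1 := by
    intro u hu j hj I hI huI
    obtain ⟨hjI, k, hk, hkT⟩ := (hΔ _ _ _).1 hI
    obtain ⟨hkL, hku⟩ := hTL u hu j hj k hkT
    rcases I.eq_or_eq_or_eq huI hjI hk with h | h | h
    · exact hu (h ▸ hj)
    · exact hku h.symm
    · exact hkL (h ▸ hj)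
  refine ⟨tripleMessages H ∪ pairing R₂ A e ∪ pairing R₃ A e ∪
      (pairing R₄ A e ∪ (unicastSet L T U).image fun x => {x}),
    ⟨pairing R₂ A e, pairing R₃ A e, pairing R₄ A e ∪ (unicastSet L T U).image fun x => {x},
      fun j => Finset.univ.filter fun I => I.1 ⊆ L ∧ w I = j, Δ, ?_, ?_, ?_, ?_, ?_, ?_⟩, ?_,
      (pairing R A e).card, (unicastSet L T U).card, huni, ?_, ?_⟩
  · rw [hHdef]
  · rw [hLdef]
    refine ⟨e, fun j hj k hk hjk => ?_, fun m => ?_⟩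
    · rw [← hAL j hj, ← hAL k hk]
      exact he j k ((hR j k).2 (Or.inl ((hR₂ j k).2 ⟨hj, hk, hjk⟩)))
    · rw [mem_pairing]
      constructor
      · rintro ⟨u, v, hr, I, hI, rfl⟩
        obtain ⟨hu, hv, huv⟩ := (hR₂ u v).1 hr
        rw [hAL u hu] at hI
        exact ⟨u, hu, v, hv, huv, I, hI, rfl⟩
      · rintro ⟨u, hu, v, hv, huv, I, hI, rfl⟩
        exact ⟨u, v, (hR₂ u v).2 ⟨hu, hv, huv⟩, I, by rwa [hAL u hu], rfl⟩
  · simp only [IsLamPartition, hLdef, hHdef]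
    refine ⟨fun i hi => ⟨?_, ?_⟩, ?_, ?_⟩
    · ext I
      rw [hLam i ((hHL i).1 hi)]
      simp only [Finset.mem_biUnion, Finset.mem_filter, Finset.mem_univ, true_and]
      exact ⟨fun ⟨_, _, h, _⟩ => h, fun h => ⟨w I, h (hw I h), h, rfl⟩⟩
    · intro j hj I hI
      simp only [Finset.mem_filter, Finset.mem_univ, true_and] at hI
      rw [havail i ((hHL i).1 hi)]
      exact ⟨fun h => (hHL i).1 hi (hI.1 h), hI.2 ▸ hw I hI.1⟩
    · intro j _ k _ hjk
      rw [Finset.disjoint_left]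
      intro I h1 h2
      simp only [Finset.mem_filter, Finset.mem_univ, true_and] at h1 h2
      exact hjk (h1.2.symm.trans h2.2)
    · intro j hj k hk
      have h1 := hwc j hj
      have h2 := hwc k hk
      omega
  · rw [hLdef, hHdef]
    intro i hi j hj I hI
    have hi := (hHL i).1 hi
    rw [hOmega i hi]
    have hu := hΔu i hi j hj I hI
    obtain ⟨hjI, k, hk, hkT⟩ := (hΔ _ _ _).1 hI
    exact ⟨hu, hjI, k, hk, (hTL i hi j hj k hkT).1⟩
  -- The set prescribed for the cross-level step is the one that `highSet` assigns to supplier `j`,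
  -- already matched by `e`.
  · have hFs : ∀ i ∉ L, ∀ j ∈ L, (Finset.univ.filter fun I : Pair K => I.1 ⊆ L ∧ w I = j) ∪
        (Omega Nh P d i j \ Δ i j) = A i j := by
      intro i hi j hj
      ext I
      rw [hAH i hi, mem_highSet_low hj, Finset.mem_union, Finset.mem_sdiff, hOmega i hi, hΔ]
      simp only [Finset.mem_filter, Finset.mem_univ, true_and]
      constructor
      · rintro (⟨h1, rfl⟩ | ⟨⟨h1, h2, k, hk, hkL⟩, h3⟩)
        · exact ⟨fun h => hi (h1 h), hw I h1, Or.inl ⟨h1, rfl⟩⟩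
        · exact ⟨h1, h2, Or.inr ⟨k, hk, hkL, fun h => h3 ⟨h2, k, hk, h⟩⟩⟩
      · rintro ⟨h1, h2, h3 | ⟨k, hk, hkL, hkT⟩⟩
        · exact Or.inl h3
        · refine Or.inr ⟨⟨h1, h2, k, hk, hkL⟩, ?_⟩
          rintro ⟨-, k', hk', hkT'⟩
          have hkL' := (hTL i hi j hj k' hkT').1
          rcases I.eq_or_eq_or_eq h2 hk hk' with h | h | h
          · exact hkL (h ▸ hj)
          · exact hkL' (h ▸ hj)
          · exact hkT (h ▸ hkT')
    simp only [IsCrossDelivery, hLdef, hHdef]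
    refine ⟨e, fun i hi j hj => ?_, fun m => ?_⟩
    · rw [hFs i ((hHL i).1 hi) j hj, ← hAL j hj]
      exact he i j ((hR i j).2 (Or.inr (Or.inl ((hR₃ i j).2 ⟨(hHL i).1 hi, hj⟩))))
    · rw [mem_pairing]
      constructor
      · rintro ⟨u, v, hr, I, hI, rfl⟩
        obtain ⟨hu, hv⟩ := (hR₃ u v).1 hr
        exact ⟨u, (hHL u).2 hu, v, hv, I, by rwa [hFs u hu v hv], rfl⟩
      · rintro ⟨u, hu, v, hv, I, hI, rfl⟩
        rw [hFs u ((hHL u).1 hu) v hv] at hI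
        exact ⟨u, v, (hR₃ u v).2 ⟨(hHL u).1 hu, hv⟩, I, hI, rfl⟩
  · have hsub₄ : pairing R₄ A e ⊆ pairing R A e := by
      rw [hpair]
      exact Finset.subset_union_right
    simp only [IsResidualDelivery, hLdef, hHdef]
    refine ⟨fun x => ?_, ?_, ?_, ?_⟩
    · have h1 : (∃ m ∈ pairing R₄ A e ∪ (unicastSet L T U).image fun x => {x}, x ∈ m) ↔
          (∃ m ∈ pairing R₄ A e, x ∈ m) ∨ x ∈ unicastSet L T U := by
        simp only [Finset.mem_union, Finset.mem_image]
        constructor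
        · rintro ⟨m, h | ⟨y, hy, rfl⟩, hx⟩
          · exact Or.inl ⟨m, h, hx⟩
          · rw [Finset.mem_singleton] at hx
            exact Or.inr (hx ▸ hy)
        · rintro (⟨m, h, hx⟩ | h)
          · exact ⟨m, Or.inl h, hx⟩
          · exact ⟨{x}, Or.inr ⟨x, h, rfl⟩, by simp⟩
      rw [h1, mem_of_mem_pairing he₄]
      obtain ⟨u, I⟩ := x
      constructor
      · rintro (⟨v, hr, hI⟩ | h)
        · have huv : u ∉ L ∧ v ∉ L := by
            rw [hR₄, hR₄] at hr
            rcases hr with ⟨h1, h2, -⟩ | ⟨h1, h2, -⟩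
            · exact ⟨h1, h2⟩
            · exact ⟨h2, h1⟩
          rw [hAH u huv.1, mem_highSet_high huv.2] at hI
          obtain ⟨-, hvI, j, hj, hjL, hjU⟩ := hI
          exact ⟨(hHL u).2 huv.1, j, hjL, (hΔ _ _ _).2 ⟨hj, v, hvI, hUT u huv.1 j hjL hjU⟩⟩
        · obtain ⟨hu, huI, j, hj, hjL, k, hk, hkT, -⟩ := (Finset.mem_filter.1 h).2
          exact ⟨(hHL u).2 hu, j, hjL, (hΔ _ _ _).2 ⟨hj, k, hk, hkT⟩⟩
      · rintro ⟨hu, j, hjL, hI⟩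
        replace hu := (hHL u).1 hu
        have huI := hΔu u hu j hjL I hI
        obtain ⟨hj, k, hk, hkT⟩ := (hΔ _ _ _).1 hI
        obtain ⟨hkL, hku⟩ := hTL u hu j hjL k hkT
        by_cases hkU : k ∈ U j u
        · refine Or.inl ⟨k, ?_, ?_⟩
          · rw [hR₄, hR₄]
            rcases lt_or_gt_of_ne hku with h | h
            · exact Or.inr ⟨hkL, hu, h⟩
            · exact Or.inl ⟨hu, hkL, h⟩
          · rw [hAH u hu, mem_highSet_high hkL]
            exact ⟨huI, hk, j, hj, hjL, hkU⟩
        · exact Or.inr (Finset.mem_filter.2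
            ⟨Finset.mem_univ _, hu, huI, j, hj, hjL, k, hk, hkT, hkU⟩)
    · have hd := pairing_disjoint hasymm he fun u v v' I _ _ => hdisj u v v' I
      intro m hm m' hm' hne
      simp only [Finset.mem_union, Finset.mem_image] at hm hm'
      rcases hm with hm | ⟨y, hy, rfl⟩ <;> rcases hm' with hm' | ⟨y', hy', rfl⟩
      · exact hd m (hsub₄ hm) m' (hsub₄ hm') hne
      · rw [Finset.disjoint_singleton_right]
        exact fun h => hpairuni m (hsub₄ hm) y' h hy'
      · rw [Finset.disjoint_singleton_left]
        exact fun h => hpairuni m' (hsub₄ hm') y h hy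
      · rw [Finset.disjoint_singleton_left, Finset.mem_singleton]
        rintro rfl
        exact hne rfl
    · intro m hm
      simp only [Finset.mem_union, Finset.mem_image] at hm
      rcases hm with hm | ⟨y, hy, rfl⟩
      · obtain ⟨u, v, hr, I, hI, rfl⟩ := mem_pairing.1 hm
        have hI' := (he₄ u v hr).mapsTo hI
        obtain ⟨hu, hv, huv⟩ := (hR₄ u v).1 hr
        exact Or.inr ⟨u, (hHL u).2 hu, v, (hHL v).2 hv, huv.ne, I, hsub _ _ hI, _, hsub _ _ hI',
          rfl⟩
      · exact Or.inl ⟨y, rfl⟩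
    · refine le_trans (Finset.card_le_card (t := (unicastSet L T U).image fun x => {x}) ?_)
        (le_trans Finset.card_image_le huni)
      intro m hm
      rw [Finset.mem_filter, Finset.mem_union] at hm
      rcases hm.1 with h | h
      · have := card_of_mem_pairing hirr (hsub₄ h)
        omega
      · exact h
  · refine decodable_of_forall_missing split P d _ fun u I hI => ?_
    rcases (hmissing (u, I)).1 hI with ⟨huI, hu, hIH⟩ | h | h
    · simp only at huI hu hIH
      -- The triple is `u` with the two users of `I`. The index of each other sub-file of the
      -- message contains `u`, so `u` caches it.
      refine ⟨Finset.univ.filter fun x => x.1 ∈ insert u I.1 ∧ x.2.1 = (insert u I.1).erase x.1,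
        ?_, ?_, ?_⟩
      · refine Finset.mem_union_left _ (Finset.mem_union_left _ (Finset.mem_union_left _ ?_))
        exact mem_tripleMessages.2 ⟨insert u I.1, Finset.insert_subset hu hIH,
          by rw [Finset.card_insert_of_notMem huI, I.2], rfl⟩
      · simp [Finset.erase_insert huI]
      · rintro ⟨s, I'⟩ hx hne
        simp only [Finset.mem_filter, Finset.mem_univ, true_and] at hx ⊢
        have hs : s ∉ L := (hHL s).1 (Finset.insert_subset hu hIH hx.1)
        rw [hPH s hs, hx.2]
        have hsu : s ≠ u := by
          rintro rfl
          apply hne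
          rw [Prod.mk.injEq]
          exact ⟨rfl, Subtype.ext (by rw [hx.2, Finset.erase_insert huI])⟩
        simp [hsu.symm]
    · obtain ⟨m, hm, hx⟩ := (hcover (u, I)).2 h
      refine ⟨m, ?_, hx, fun x hxm hne =>
        mem_cache_of_mem_pairing he (fun u v _ => hsub u v) hm (u, I) hx x hxm hne.symm⟩
      rw [hpair] at hm
      simp only [Finset.mem_union] at hm ⊢
      rcases hm with (hm | hm) | hm <;> simp [hm]
    · refine ⟨{(u, I)}, ?_, by simp, fun x hx hne => absurd (Finset.mem_singleton.1 hx) hne⟩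
      exact Finset.mem_union_right _ (Finset.mem_union_right _ (Finset.mem_image.2 ⟨_, h, rfl⟩))
  · have h1 : tripleMessages H ∪ pairing R₂ A e ∪ pairing R₃ A e ∪
        (pairing R₄ A e ∪ (unicastSet L T U).image fun x => {x}) =
        tripleMessages H ∪ (pairing R A e ∪ (unicastSet L T U).image fun x => {x}) := by
      rw [hpair]
      simp only [Finset.union_assoc]
    -- Triple messages carry only indices inside `H`; the other messages never serve such demands,
    -- so no message is counted in both families.
    have htriple : ∀ m ∈ tripleMessages H, ∀ x ∈ m, x.1 ∉ x.2.1 ∧ x.1 ∈ H ∧ x.2.1 ⊆ H := by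
      intro m hm x hx
      obtain ⟨S, hS, -, rfl⟩ := mem_tripleMessages.1 hm
      obtain ⟨hxS, hx2⟩ := (Finset.mem_filter.1 hx).2
      rw [hx2]
      exact ⟨by simp, hS hxS, (Finset.erase_subset _ _).trans hS⟩
    rw [h1, Finset.card_union_of_disjoint, Finset.card_union_of_disjoint, card_tripleMessages,
      Finset.card_image_of_injective _ Finset.singleton_injective]
    · rw [Finset.disjoint_left]
      intro m hm hm'
      obtain ⟨x, hx, rfl⟩ := Finset.mem_image.1 hm'
      exact hpairuni _ hm x (Finset.mem_singleton_self x) hx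
    · rw [Finset.disjoint_left]
      intro m hm hm'
      rcases Finset.mem_union.1 hm' with hm' | hm'
      · obtain ⟨x, hx⟩ : m.Nonempty :=
          Finset.card_pos.1 (by rw [card_of_mem_pairing hirr hm']; norm_num)
        obtain ⟨v, hv⟩ := (hcover x).1 ⟨m, hm', hx⟩
        exact (hexcl x (htriple m hm x hx)).1 v hv
      · obtain ⟨x, hx, rfl⟩ := Finset.mem_image.1 hm'
        exact (hexcl x (htriple _ hm x (Finset.mem_singleton_self x))).2 hx
  · have hsum : ∑ u, (missing P d u).card =
        (Finset.univ.filter fun x : Fin K × Pair K => x.1 ∉ P (d x.1) x.2).card := by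
      rw [Finset.card_filter, Fintype.sum_prod_type]
      simp only [← Finset.card_filter, missing]
    -- Double counting of the missing sub-files: two for each paired message, one for each unicast,
    -- and `3 * C(h, 3)` in the triples.
    have hunion : (Finset.univ.filter fun x : Fin K × Pair K => x.1 ∉ P (d x.1) x.2) =
        ((pairing R A e).biUnion id ∪ unicastSet L T U) ∪
          Finset.univ.filter fun x : Fin K × Pair K => x.1 ∉ x.2.1 ∧ x.1 ∈ H ∧ x.2.1 ⊆ H := by
      ext x
      have hx := hcover x
      simp only [Finset.mem_union, Finset.mem_filter, Finset.mem_univ, true_and,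
        Finset.mem_biUnion, id, hmissing x, hx]
      rw [or_comm]
    rw [hsum, hunion, Finset.card_union_of_disjoint, Finset.card_union_of_disjoint,
      card_filter_subset_of_notMem,
      two_mul_card_pairing hasymm he fun u v v' I _ _ => hdisj u v v' I]
    · rw [Finset.disjoint_left]
      intro x hx hx'
      obtain ⟨m, hm, hxm⟩ := Finset.mem_biUnion.1 hx
      exact hpairuni m hm x hxm hx'
    · rw [Finset.disjoint_left]
      intro x hx hx'
      have h := hexcl x (Finset.mem_filter.1 hx').2
      rcases Finset.mem_union.1 hx with hx | hx
      · obtain ⟨m, hm, hxm⟩ := Finset.mem_biUnion.1 hx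
        obtain ⟨v, hv⟩ := (hcover x).1 ⟨m, hm, hxm⟩
        exact h.1 v hv
      · exact h.2 hx

/-! ### The rate and the conclusion. -/

lemma ceil_half_eq {p ε : ℕ} (h : ε ≤ 1) : ⌈((2 * p + ε : ℕ) : ℚ) / 2⌉ = ((p + ε : ℕ) : ℤ) := by
  rw [Int.ceil_eq_iff]
  have h' : (ε : ℚ) ≤ 1 := by exact_mod_cast h
  have h0 : (0 : ℚ) ≤ ε := by positivity
  push_cast
  interval_cases ε <;> constructor <;> norm_num <;> linarith

end CL21

theorem lemma1 (K N Nh F b : ℕ) (hK : 2 ≤ K) (hdiv : K ∣ K.choose 2) (hN : Nh ≤ N) (hb : 0 < b)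
    (split : Fin F ≃ CL21.Pair K × Fin b) :
    (∃ P : CL21.Placement K N, CL21.IsCL21Placement Nh P) ∧
    ∀ P : CL21.Placement K N, CL21.IsCL21Placement Nh P →
      (∀ u : Fin K,
        ((CL21.cachedBits split P u).card : ℚ) = CL21.cacheSize K Nh N 2 * (F : ℚ)) ∧
      ∀ d : Fin K → Fin N,
        ((∑ u : Fin K, (CL21.missing P d u).card : ℕ) : ℚ) =
          CL21.totalMissing K (CL21.highUsers Nh d).card (CL21.lowUsers Nh d).card ∧
        ∃ D : Finset (CL21.Message K),
          CL21.IsCL21Delivery Nh P d D ∧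
          CL21.Decodable split P d D ∧
          CL21.deliveryRate F b D =
            CL21.cl21Rate K (CL21.highUsers Nh d).card (CL21.lowUsers Nh d).card := by
  obtain ⟨q, hq, hc⟩ := CL21.eq_two_mul_add_one_of_dvd_choose hK hdiv
  have hF := CL21.card_file_eq split
  have hF' : (F : ℚ) = (K.choose 2 : ℚ) * b := by exact_mod_cast hF
  have hb' : (b : ℚ) ≠ 0 := by positivity
  have hK0 : (K : ℚ) ≠ 0 := by positivity
  have hC0 : (K.choose 2 : ℚ) ≠ 0 := by
    have := Nat.choose_pos hK
    positivity
  have hrate : ∀ D : Finset (CL21.Message K),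
      CL21.deliveryRate F b D = (D.card : ℚ) / K.choose 2 := by
    intro D
    rw [CL21.deliveryRate, hF', mul_div_mul_right _ _ hb']
  refine ⟨CL21.exists_isCL21Placement hq hc Nh, fun P hP => ⟨fun u => ?_, fun d => ?_⟩⟩
  · rw [CL21.card_cachedBits hq hc hN split hP, CL21.cacheSize, hF', hc]
    push_cast
    field_simp
    ring
  · have hL := CL21.sum_card_missing hq hc hP d
    refine ⟨hL, ?_⟩
    by_cases hkh : 2 ≤ (CL21.highUsers Nh d).card
    · obtain ⟨D, h1, h2, p, ε, hε, h3, h4⟩ := CL21.exists_fourStepDelivery hq hc split hP d hkh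
      refine ⟨D, ⟨fun _ => h1, fun h => absurd h (by omega)⟩, h2, ?_⟩
      -- The demands left after the triples number `2p + ε`, and `p + ε` messages serve them; since
      -- `ε ≤ 1`, this is the ceiling of half their number.
      have h5 : CL21.totalMissing K (CL21.highUsers Nh d).card (CL21.lowUsers Nh d).card -
          3 * ((CL21.highUsers Nh d).card.choose 3 : ℚ) = ((2 * p + ε : ℕ) : ℚ) := by
        rw [← hL, ← h4]
        push_cast
        ring
      rw [hrate, CL21.cl21Rate, if_pos hkh, h5, CL21.ceil_half_eq hε, h3]
      push_cast
      rfl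
    · obtain ⟨D, h1, h2, h3⟩ := CL21.exists_fallbackDelivery hq hc split hP d
      refine ⟨D, ⟨fun h => absurd h hkh, fun _ => h1⟩, h2, ?_⟩
      have hq' : (K : ℚ) = 2 * q + 1 := by exact_mod_cast hq
      rw [hrate, CL21.cl21Rate, if_neg hkh, h3]
      push_cast
      rw [mul_div_cancel_left₀ _ hC0, hq']
      ring
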